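/- Let $\mathsf X\subseteq\mathbb R^d$ be open and $K\subseteq\mathsf X$ compact and convex. Let $f:\mathsf X\to\mathbb R$ be continuously differentiable, and let $g:\mathsf X\to\mathbb R$ be locally Lipschitz, bounded from below and regular. Here, for $x\in\mathsf X$ and $h\in\mathbb R^d$, $$g^0(x,h)=\lim_{\delta\downarrow0}\ \sup_{\|\tilde h\|\le\delta,\;0<\lambda<\delta}\frac{g(x+\tilde h+\lambda h)-g(x+\tilde h)}{\lambda},$$ and $g$ is regular if for all $x\in\mathsf X$, $h\in\mathbb R^d$ the limit $\lim_{\lambda\downarrow0}(g(x+\lambda h)-g(x))/\lambda$ exists and equals $g^0(x,h)$. Let $\bar\partial g(x)=\{\zeta\in\mathbb R^d: \langle h,\zeta\rangle\le g^0(x,h)\text{ for all }h\in\mathbb R^d\}$ be the Clarke gradient, and for $x\in K$ let $N_K(x)=\{v\in\mathbb R^d:\langle v,z-x\rangle\le0\text{ for all }z\in K\}$ be the normal cone. Put $$\mathcal S=\{x\in K:\ 0\in\nabla f(x)+\bar\partial g(x)+N_K(x)\}.$$ For $\gamma>0$, $w\in\mathbb R^d$ and $h:\mathsf X\to(-\infty,\infty]$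 let $\mathrm{prox}_{\gamma h}(w)$ be the (possibly empty) set of minimizers over $y\in\mathsf X$ of $h(y)+\frac1{2\gamma}\|y-w\|^2$; let $\mathbb I_K$ be $0$ on $K$ and $+\infty$ off $K$, and let $\Pi_K(A)$ be the set of the Euclidean projections onto $K$ of the points of $A$. Let $(\gamma_k)_{k\ge1}$ satisfy $\gamma_k>0$, $\sum_{k\ge1}\gamma_k=\infty$ and $\gamma_k\to0$. Let $x_0\in K$, let $(H_k)_{k\ge1}$ be a sequence in $\mathbb R^d$, let $(x_k)_{k\ge1}$ be generated from $x_0$ by one of the recursions in (i), (ii) below (so that $x_k\in K$ for all $k$), and put $\delta_k=H_k-\nabla f(x_{k-1})$ for $k\ge1$. Suppose that $\sup_{k\ge1}\|\delta_k\|<\infty$ and that $\delta_k=e_k+r_k$ with $\|r_k\|\to0$ and $\sum_{k\ge1}\gamma_ke_k$ convergent. Suppose finally that $(f+g)(\mathcal S)\subseteq\mathbb R$ has empty interior. (i) If $x_k\in\mathrm{prox}_{\gamma_k(g+\mathbb I_K)}(x_{k-1}-\gamma_kH_k)$ for all $k\ge1$, then $x_k$ converges to $\mathcal S$, that is, $\mathcal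 S\neq\emptyset$ and $\lim_{k\to\infty}\mathrm{dist}(x_k,\mathcal S)=0$. (ii) If $g$ is Lipschitz on $\mathsf X$ and $x_k\in\Pi_K(\mathrm{prox}_{\gamma_kg}(x_{k-1}-\gamma_kH_k))$ for all $k\ge1$, then $x_k$ converges to $\mathcal S$ in the same sense. -/

import Mathlib

open Filter Topology Set
open scoped Pointwise

namespace ProxSGD

variable {E : Type*} [NormedAddCommGroup E] [InnerProductSpace ℝ E]

/-- Clarke's generalized directional derivative `f⁰(x; h)`: the limit, as `δ ↓ 0`, of the supremum
of `(f (x + h' + t h) - f (x + h')) / t` over `‖h'‖ ≤ δ` and `0 < t < δ`.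
It only depends on the values of `f` near `x`, and is used where `f` is Lipschitz near `x`,
so that the quotients are bounded and this real upper limit is the genuine one. -/
noncomputable def clarkeDeriv (f : E → ℝ) (x h : E) : ℝ :=
  limsup (fun p : E × ℝ => (f (x + p.1 + p.2 • h) - f (x + p.1)) / p.2)
    (𝓝 (0 : E) ×ˢ 𝓝[>] (0 : ℝ))

/-- Clarke's generalized gradient of `f` at `x`. -/
def clarkeGradient (f : E → ℝ) (x : E) : Set E :=
  {v | ∀ h : E, inner ℝ h v ≤ clarkeDeriv f x h}

/-- `f` is (Clarke) regular at `x`: it is Lipschitz near `x`, and all one-sided directional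
derivatives exist and agree with the generalized directional derivatives. -/
def RegularAt (f : E → ℝ) (x : E) : Prop :=
  (∃ L : NNReal, ∃ t ∈ 𝓝 x, LipschitzOnWith L f t) ∧
  ∀ h : E, Tendsto (fun t : ℝ => (f (x + t • h) - f x) / t) (𝓝[>] 0) (𝓝 (clarkeDeriv f x h))

/-- The normal cone to the convex set `K` at the point `x` of `K`. -/
def normalCone (K : Set E) (x : E) : Set E :=
  {v | ∀ z ∈ K, inner ℝ v (z - x) ≤ 0}

open Classical in
/-- The convex indicator function of `K`: `0` on `K` and `∞` elsewhere. -/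
noncomputable def convexIndicator (K : Set E) (x : E) : EReal :=
  if x ∈ K then 0 else ⊤

/-- The set-valued proximal operator on `X`:
all minimizers over `y ∈ X` of `h y + ‖y - w‖² / (2 γ)`. -/
def prox (X : Set E) (γ : ℝ) (h : E → EReal) (w : E) : Set E :=
  {y | y ∈ X ∧ IsMinOn (fun z => h z + (((2 * γ)⁻¹ * ‖z - w‖ ^ 2 : ℝ) : EReal)) X y}

/-- The set `Π_K(A)` of projections (nearest points in `K`) of the elements of `A`. -/
def projSet (K A : Set E) : Set E :=
  {p | ∃ a ∈ A, p ∈ K ∧ ∀ z ∈ K, ‖a - p‖ ≤ ‖a - z‖}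

/-- The stationary points in `K` of the composite function `f + g`. -/
def stationarySet [CompleteSpace E] (K : Set E) (f g : E → ℝ) : Set E :=
  {x | x ∈ K ∧ (0 : E) ∈ ({gradient f x} : Set E) + clarkeGradient g x + normalCone K x}

/-- The gradient perturbation `δ_k = H_k - ∇ f (x_{k-1})`, meaningful for `k ≥ 1`. -/
noncomputable def gradNoise [CompleteSpace E] (f : E → ℝ) (x H : ℕ → E) (k : ℕ) : E :=
  H k - gradient f (x (k - 1))

/-- The distance from `x k` to `S` tends to `0`. The extended distance to the empty set is `∞`,
so this forces `S` to be nonempty. -/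
def ConvergesToSet (x : ℕ → E) (S : Set E) : Prop :=
  Tendsto (fun k => Metric.infEDist (x k) S) atTop (𝓝 0)

end ProxSGD

/-! The iterates shadow a differential inclusion for which `V = f + g` is a Lyapunov function.
Optimality of a proximal point and Hahn–Banach turn both schemes into `IsInclusionStep`: a step
along `-(H + ζ + ν)`, with `ζ` a Clarke subgradient at a nearby point, `ν` normal to `K`, both
bounded. In the time scale of the step sizes, the sequence restarted at index `n` and passed to an
ultrafilter limit in `n` gives a Lipschitz arc with velocity in `-(∇f + ∂g + N_K)` almost everywhere
(`exists_isDescentArc`); the noise disappears because its weighted sums over bounded time windows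
tend to zero. Regularity of `g` supplies a chain rule, whence `V' ≤ -‖z'‖²` along such an arc
(`deriv_comp_le_neg_norm_sq`). So `V` decreases, and it can stay constant for a while only if the
arc starts at a stationary point. If `V (x n)` diverged, it would upcross some interval `[a, b]`
infinitely often with `a` not a stationary value, such values being dense. The arc started at these
upcrossings has `V = a` at time 0 and `V < a` at time 1, so the upcrossings end within bounded time,
and the arc would reach a value at least `b > a`, which is absurd. Hence `V (x n)` converges, `V` is
constant on every limit arc, and every cluster point is stationary. -/

namespace ProxSGD

/-! ### Clarke directional derivatives and gradients. -/

section ClarkeCalculus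

variable {E : Type*} [NormedAddCommGroup E] [InnerProductSpace ℝ E]

lemma tendsto_shifted_base (x h : E) :
    Tendsto (fun p : E × ℝ => x + p.1 + p.2 • h) (𝓝 (0 : E) ×ˢ 𝓝[>] (0 : ℝ)) (𝓝 x) := by
  have h1 : Tendsto (fun p : E × ℝ => x + p.1 + p.2 • h) (𝓝 ((0 : E), (0 : ℝ))) (𝓝 x) := by
    have : Continuous (fun p : E × ℝ => x + p.1 + p.2 • h) := by fun_prop
    simpa using this.tendsto ((0 : E), (0 : ℝ))
  refine h1.mono_left ?_
  rw [nhds_prod_eq]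
  exact Filter.prod_mono le_rfl nhdsWithin_le_nhds

lemma eventually_abs_quotient_le {g : E → ℝ} {x : E} {L : NNReal} {t : Set E} (ht : t ∈ 𝓝 x)
    (hL : LipschitzOnWith L g t) (h : E) :
    ∀ᶠ p : E × ℝ in 𝓝 (0 : E) ×ˢ 𝓝[>] (0 : ℝ),
      |(g (x + p.1 + p.2 • h) - g (x + p.1)) / p.2| ≤ L * ‖h‖ := by
  have h1 := (tendsto_shifted_base x h).eventually ht
  have h2 := (tendsto_shifted_base x (0 : E)).eventually ht
  have h3 : ∀ᶠ p : E × ℝ in 𝓝 (0 : E) ×ˢ 𝓝[>] (0 : ℝ), 0 < p.2 :=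
    tendsto_snd.eventually self_mem_nhdsWithin
  filter_upwards [h1, h2, h3] with p hp1 hp2 hp3
  rw [smul_zero, add_zero] at hp2
  have h4 := hL.dist_le_mul _ hp1 _ hp2
  rw [Real.dist_eq, dist_eq_norm, add_sub_cancel_left, norm_smul, Real.norm_eq_abs,
    abs_of_pos hp3] at h4
  rw [abs_div, abs_of_pos hp3, div_le_iff₀ hp3]
  linarith

/-- The Lipschitz bound keeps the quotients bounded below, so that the real `limsup` is not a
default value. -/
lemma clarkeDeriv_le_of_eventually {g : E → ℝ} {x h : E} {c : ℝ}
    (hg : ∃ L : NNReal, ∃ t ∈ 𝓝 x, LipschitzOnWith L g t)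
    (hc : ∀ᶠ p : E × ℝ in 𝓝 (0 : E) ×ˢ 𝓝[>] (0 : ℝ),
      (g (x + p.1 + p.2 • h) - g (x + p.1)) / p.2 ≤ c) : clarkeDeriv g x h ≤ c := by
  obtain ⟨L, t, ht, hL⟩ := hg
  refine limsup_le_of_le ?_ hc
  refine IsBoundedUnder.isCoboundedUnder_le ⟨-(L * ‖h‖), ?_⟩
  rw [eventually_map]
  filter_upwards [eventually_abs_quotient_le ht hL h] with p hp using (abs_le.1 hp).1

lemma eventually_lt_of_clarkeDeriv_lt {g : E → ℝ} {x h : E} {c : ℝ}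
    (hg : ∃ L : NNReal, ∃ t ∈ 𝓝 x, LipschitzOnWith L g t) (hc : clarkeDeriv g x h < c) :
    ∀ᶠ p : E × ℝ in 𝓝 (0 : E) ×ˢ 𝓝[>] (0 : ℝ),
      (g (x + p.1 + p.2 • h) - g (x + p.1)) / p.2 < c := by
  obtain ⟨L, t, ht, hL⟩ := hg
  refine eventually_lt_of_limsup_lt hc ⟨L * ‖h‖, ?_⟩
  rw [eventually_map]
  filter_upwards [eventually_abs_quotient_le ht hL h] with p hp using (abs_le.1 hp).2

lemma clarkeDeriv_le_mul_norm {g : E → ℝ} {x : E} {L : NNReal} {t : Set E} (ht : t ∈ 𝓝 x)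
    (hL : LipschitzOnWith L g t) (h : E) : clarkeDeriv g x h ≤ L * ‖h‖ :=
  clarkeDeriv_le_of_eventually ⟨L, t, ht, hL⟩
    ((eventually_abs_quotient_le ht hL h).mono fun _ hp => (abs_le.1 hp).2)

lemma norm_le_of_mem_clarkeGradient {g : E → ℝ} {x v : E} {L : ℝ} (hL0 : 0 ≤ L)
    (hL : ∀ h, clarkeDeriv g x h ≤ L * ‖h‖) (hv : v ∈ clarkeGradient g x) : ‖v‖ ≤ L := by
  have h1 := (hv v).trans (hL v)
  rw [real_inner_self_eq_norm_sq] at h1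
  rcases (norm_nonneg v).eq_or_lt with h0 | h0
  · rw [← h0]; exact hL0
  · nlinarith

/-- The quotient is split at the intermediate point `x + h' + t b`. This is again an admissible base
point, because the upper limit runs over all base points near `x`. -/
lemma clarkeDeriv_add_le {g : E → ℝ} {x : E}
    (hg : ∃ L : NNReal, ∃ t ∈ 𝓝 x, LipschitzOnWith L g t) (a b : E) :
    clarkeDeriv g x (a + b) ≤ clarkeDeriv g x a + clarkeDeriv g x b := by
  refine le_of_forall_pos_le_add fun ε hε => ?_
  have ha := eventually_lt_of_clarkeDeriv_lt (h := a) hg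
    (lt_add_of_pos_right (clarkeDeriv g x a) (half_pos hε))
  have hb := eventually_lt_of_clarkeDeriv_lt (h := b) hg
    (lt_add_of_pos_right (clarkeDeriv g x b) (half_pos hε))
  have hshift : Tendsto (fun p : E × ℝ => (p.1 + p.2 • b, p.2))
      (𝓝 (0 : E) ×ˢ 𝓝[>] (0 : ℝ)) (𝓝 (0 : E) ×ˢ 𝓝[>] (0 : ℝ)) := by
    refine Tendsto.prodMk ?_ tendsto_snd
    simpa using tendsto_shifted_base (0 : E) b
  refine clarkeDeriv_le_of_eventually hg ?_
  filter_upwards [hshift.eventually ha, hb] with p hpa hpb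
  have e : x + p.1 + p.2 • (a + b) = x + (p.1 + p.2 • b) + p.2 • a := by
    rw [smul_add]; abel
  have e2 : x + (p.1 + p.2 • b) = x + p.1 + p.2 • b := by abel
  rw [e]
  simp only [e2] at hpa ⊢
  have : (g (x + p.1 + p.2 • b + p.2 • a) - g (x + p.1)) / p.2 =
      (g (x + p.1 + p.2 • b + p.2 • a) - g (x + p.1 + p.2 • b)) / p.2 +
        (g (x + p.1 + p.2 • b) - g (x + p.1)) / p.2 := by ring
  rw [this]
  linarith

lemma RegularAt.clarkeDeriv_smul {g : E → ℝ} {x : E} (hg : RegularAt g x) {c : ℝ} (hc : 0 < c)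
    (h : E) : clarkeDeriv g x (c • h) = c * clarkeDeriv g x h := by
  have h1 := hg.2 (c • h)
  have h2 : Tendsto (fun t : ℝ => t * c) (𝓝[>] 0) (𝓝[>] 0) := by
    refine tendsto_nhdsWithin_iff.2 ⟨?_, ?_⟩
    · have : Tendsto (fun t : ℝ => t * c) (𝓝 0) (𝓝 (0 * c)) := tendsto_id.mul_const c
      rw [zero_mul] at this
      exact this.mono_left nhdsWithin_le_nhds
    · filter_upwards [self_mem_nhdsWithin] with t ht
      exact mul_pos ht hc
  have h3 := ((hg.2 h).comp h2).const_mul c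
  refine tendsto_nhds_unique h1 (h3.congr fun t => ?_)
  simp only [Function.comp, smul_smul]
  rw [← mul_div_assoc, mul_comm t c, mul_div_mul_left _ _ hc.ne']

/-- Upper semicontinuity in the base point: the displacement `y - x` is absorbed into the
perturbation. It is what makes limits of Clarke subgradients Clarke subgradients. -/
lemma eventually_clarkeDeriv_le {g : E → ℝ} {x h : E} {c : ℝ}
    (hg : ∃ L : NNReal, ∃ t ∈ 𝓝 x, LipschitzOnWith L g t) (hc : clarkeDeriv g x h < c) :
    ∀ᶠ y in 𝓝 x, clarkeDeriv g y h ≤ c := by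
  obtain ⟨U, hU, W, hW, hUW⟩ := mem_prod_iff.1 (eventually_lt_of_clarkeDeriv_lt hg hc)
  obtain ⟨L, t, ht, hL⟩ := hg
  have h1 : Tendsto (fun q : E × E => q.1 - x + q.2) (𝓝 x ×ˢ 𝓝 0) (𝓝 0) := by
    have : Continuous (fun q : E × E => q.1 - x + q.2) := by fun_prop
    rw [← nhds_prod_eq]
    simpa using this.tendsto (x, (0 : E))
  have h2 := (h1.eventually hU).curry
  filter_upwards [h2, eventually_mem_nhds_iff.2 ht] with y hy hyt
  refine clarkeDeriv_le_of_eventually ⟨L, t, hyt, hL⟩ ?_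
  filter_upwards [prod_mem_prod hy hW] with p hp
  have h3 := @hUW (y - x + p.1, p.2) ⟨hp.1, hp.2⟩
  have e : x + (y - x + p.1) = y + p.1 := by abel
  simp only [mem_ofPred_eq, e] at h3
  exact h3.le

lemma exists_clarkeDeriv_le_on_compact {g : E → ℝ} {K : Set E} (hK : IsCompact K)
    (hg : ∀ x ∈ K, ∃ L : NNReal, ∃ t ∈ 𝓝 x, LipschitzOnWith L g t) :
    ∃ L : ℝ, 0 ≤ L ∧ ∀ x ∈ K, ∀ h, clarkeDeriv g x h ≤ L * ‖h‖ := by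
  refine hK.induction_on (p := fun s => ∃ L : ℝ, 0 ≤ L ∧ ∀ x ∈ s, ∀ h,
    clarkeDeriv g x h ≤ L * ‖h‖) ⟨0, le_rfl, by simp⟩ ?_ ?_ ?_
  · rintro s t hst ⟨L, hL0, hL⟩
    exact ⟨L, hL0, fun x hx => hL x (hst hx)⟩
  · rintro s t ⟨L, hL0, hL⟩ ⟨M, hM0, hM⟩
    refine ⟨max L M, hL0.trans (le_max_left _ _), ?_⟩
    rintro x (hx | hx) h
    · exact (hL x hx h).trans (by gcongr; exact le_max_left _ _)
    · exact (hM x hx h).trans (by gcongr; exact le_max_right _ _)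
  · intro x hx
    obtain ⟨L, t, ht, hL⟩ := hg x hx
    refine ⟨interior t, mem_nhdsWithin_of_mem_nhds (interior_mem_nhds.2 ht), L, L.2, ?_⟩
    intro y hy h
    exact clarkeDeriv_le_mul_norm (mem_interior_iff_mem_nhds.1 hy) hL h

end ClarkeCalculus

/-! ### First-order optimality of proximal points. -/

section Optimality

variable {E : Type*} [NormedAddCommGroup E] [InnerProductSpace ℝ E]

/-- A sublinear function that is nonnegative on a convex cone `T` dominates a linear functional
that is nonnegative on `T`. -/
lemma exists_linear_le_sublinear_nonneg_on_cone {P : E → ℝ}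
    (P_hom : ∀ c : ℝ, 0 < c → ∀ x, P (c • x) = c * P x) (P_add : ∀ x y, P (x + y) ≤ P x + P y)
    {T : Set E} (T0 : (0 : E) ∈ T) (T_hom : ∀ c : ℝ, 0 < c → ∀ x ∈ T, c • x ∈ T)
    (T_add : ∀ x ∈ T, ∀ y ∈ T, x + y ∈ T) (hP : ∀ x ∈ T, 0 ≤ P x) :
    ∃ l : E →ₗ[ℝ] ℝ, (∀ x, l x ≤ P x) ∧ ∀ x ∈ T, 0 ≤ l x := by
  -- Domination by `N` encodes both requirements: `c = 0` gives `l ≤ P`, and evaluating at `-c`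
  -- gives `l (-c) ≤ P 0 = 0`. Hahn–Banach is then applied to `N` from the zero subspace.
  let N : E → ℝ := fun h => ⨅ c : T, P (h + c)
  have : Nonempty T := ⟨⟨0, T0⟩⟩
  have hbdd : ∀ h, BddBelow (range fun c : T => P (h + c)) := by
    intro h
    refine ⟨-P (-h), ?_⟩
    rintro _ ⟨c, rfl⟩
    have h1 := P_add (h + c) (-h)
    rw [show h + (c : E) + -h = c by abel] at h1
    have h2 := hP c c.2
    simp only
    linarith
  have N_le : ∀ h, ∀ c ∈ T, N h ≤ P (h + c) := fun h c hc => ciInf_le (hbdd h) (⟨c, hc⟩ : T)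
  have N_hom_le : ∀ c : ℝ, 0 < c → ∀ x, N (c • x) ≤ c * N x := by
    intro c hc x
    rw [mul_comm, ← div_le_iff₀ hc]
    refine le_ciInf fun t => ?_
    rw [div_le_iff₀ hc]
    have h1 := N_le (c • x) (c • (t : E)) (T_hom c hc t t.2)
    rw [← smul_add, P_hom c hc] at h1
    linarith
  have N_hom : ∀ c : ℝ, 0 < c → ∀ x, N (c • x) = c * N x := by
    intro c hc x
    refine le_antisymm (N_hom_le c hc x) ?_
    have h1 := N_hom_le c⁻¹ (inv_pos.2 hc) (c • x)
    rw [smul_smul, inv_mul_cancel₀ hc.ne', one_smul] at h1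
    calc c * N x ≤ c * (c⁻¹ * N (c • x)) := by gcongr
      _ = N (c • x) := by field_simp
  have N_add : ∀ x y, N (x + y) ≤ N x + N y := by
    intro x y
    rw [← sub_le_iff_le_add]
    refine le_ciInf fun s => ?_
    rw [sub_le_comm]
    refine le_ciInf fun t => ?_
    have h1 := N_le (x + y) (s + t) (T_add s s.2 t t.2)
    have h2 := P_add (x + s) (y + t)
    rw [show x + (s : E) + (y + t) = x + y + (s + t) by abel] at h2
    linarith
  have N_zero : N 0 = 0 := by
    have := N_hom 2 (by norm_num) 0
    rw [smul_zero] at this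
    linarith
  obtain ⟨l, -, hl⟩ := exists_extension_of_le_sublinear (⟨⊥, 0⟩ : E →ₗ.[ℝ] ℝ) N N_hom N_add
    (by
      rintro ⟨x, hx⟩
      have hx0 : x = 0 := by simpa using hx
      subst hx0
      simp [N_zero])
  refine ⟨l, fun x => ?_, fun x hx => ?_⟩
  · simpa using (hl x).trans (N_le x 0 T0)
  · have h1 := (hl (-x)).trans (N_le (-x) x hx)
    have h2 : P 0 = 0 := by
      have := P_hom 2 (by norm_num) 0
      rw [smul_zero] at this
      linarith
    rw [neg_add_cancel, h2, map_neg] at h1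
    linarith

lemma RegularAt.nonneg_of_quadratic_min {g : E → ℝ} {y w p : E} {γ : ℝ} (hg : RegularAt g y)
    (hγ : 0 < γ) (hmin : ∀ᶠ t : ℝ in 𝓝[>] 0, g y + (2 * γ)⁻¹ * ‖y - w‖ ^ 2 ≤
      g (y + t • p) + (2 * γ)⁻¹ * ‖y + t • p - w‖ ^ 2) :
    0 ≤ clarkeDeriv g y p + γ⁻¹ * inner ℝ (y - w) p := by
  have h1 : Tendsto (fun t : ℝ => γ⁻¹ * inner ℝ (y - w) p + (2 * γ)⁻¹ * (t * ‖p‖ ^ 2)) (𝓝[>] 0)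
      (𝓝 (γ⁻¹ * inner ℝ (y - w) p)) := by
    have hc : Continuous
        (fun t : ℝ => γ⁻¹ * inner ℝ (y - w) p + (2 * γ)⁻¹ * (t * ‖p‖ ^ 2)) := by fun_prop
    have := hc.tendsto 0
    simp only [zero_mul, mul_zero, add_zero] at this
    exact this.mono_left nhdsWithin_le_nhds
  refine ge_of_tendsto ((hg.2 p).add h1) ?_
  filter_upwards [hmin, self_mem_nhdsWithin] with t ht ht0
  have ht0 : 0 < t := ht0
  have e : ‖y + t • p - w‖ ^ 2 = ‖y - w‖ ^ 2 + 2 * (t * inner ℝ (y - w) p) + t ^ 2 * ‖p‖ ^ 2 := by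
    rw [show y + t • p - w = (y - w) + t • p by abel, norm_add_sq_real, inner_smul_right,
      norm_smul, mul_pow, Real.norm_eq_abs, sq_abs]
  rw [e] at ht
  have h2 : (g (y + t • p) - g y) / t +
      (γ⁻¹ * inner ℝ (y - w) p + (2 * γ)⁻¹ * (t * ‖p‖ ^ 2)) =
      (g (y + t • p) - g y +
        (2 * γ)⁻¹ * (2 * (t * inner ℝ (y - w) p) + t ^ 2 * ‖p‖ ^ 2)) / t := by
    field_simp
  rw [h2]
  exact div_nonneg (by linarith) ht0.le

/-- Applied on the cone of feasible directions of `K` at `x`, the separation lemma gives a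
functional whose Riesz vector `v` satisfies `v - q ∈ ∂g(x)` and `-v ∈ N_K(x)`; so `ζ = v - q`. -/
lemma exists_mem_clarkeGradient_normalCone [CompleteSpace E] {g : E → ℝ} {K : Set E} {x q : E}
    (hg : RegularAt g x) (hK : Convex ℝ K) (hx : x ∈ K)
    (hq : ∀ z ∈ K, 0 ≤ clarkeDeriv g x (z - x) + inner ℝ q (z - x)) :
    ∃ ζ ∈ clarkeGradient g x, -(q + ζ) ∈ normalCone K x := by
  have hP_hom : ∀ c : ℝ, 0 < c → ∀ h, clarkeDeriv g x (c • h) + inner ℝ q (c • h) =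
      c * (clarkeDeriv g x h + inner ℝ q h) := by
    intro c hc h
    rw [hg.clarkeDeriv_smul hc, inner_smul_right, mul_add]
  obtain ⟨l, hl, hlT⟩ := exists_linear_le_sublinear_nonneg_on_cone
    (P := fun h => clarkeDeriv g x h + inner ℝ q h)
    (T := {c | ∃ s : ℝ, 0 < s ∧ ∃ z ∈ K, c = s • (z - x)}) hP_hom
    (by
      intro a b
      have := clarkeDeriv_add_le hg.1 a b
      rw [inner_add_right]
      linarith)
    ⟨1, one_pos, x, hx, by simp⟩
    (by
      rintro c hc _ ⟨s, hs, z, hz, rfl⟩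
      exact ⟨c * s, mul_pos hc hs, z, hz, by rw [smul_smul]⟩)
    (by
      rintro _ ⟨s, hs, z, hz, rfl⟩ _ ⟨t, ht, y, hy, rfl⟩
      refine ⟨s + t, add_pos hs ht, (s / (s + t)) • z + (t / (s + t)) • y,
        hK hz hy (by positivity) (by positivity) (by field_simp), ?_⟩
      have hst : s + t ≠ 0 := (add_pos hs ht).ne'
      rw [smul_sub (s + t), smul_add, smul_smul, smul_smul, mul_div_cancel₀ _ hst,
        mul_div_cancel₀ _ hst, smul_sub, smul_sub, add_smul]
      abel)
    (by
      rintro _ ⟨s, hs, z, hz, rfl⟩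
      rw [hP_hom s hs]
      exact mul_nonneg hs.le (hq z hz))
  obtain ⟨L, t, ht, hL⟩ := hg.1
  have hbound : ∀ h, ‖l h‖ ≤ (L + ‖q‖) * ‖h‖ := by
    have key : ∀ h, l h ≤ (L + ‖q‖) * ‖h‖ := by
      intro h
      have h1 := hl h
      have h2 := clarkeDeriv_le_mul_norm ht hL h
      have h3 := real_inner_le_norm q h
      nlinarith
    intro h
    rw [Real.norm_eq_abs, abs_le]
    have h1 := key (-h)
    rw [map_neg, norm_neg] at h1
    exact ⟨by linarith, key h⟩
  let l' : E →L[ℝ] ℝ := l.mkContinuous _ hbound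
  have hv : ∀ h, inner ℝ ((InnerProductSpace.toDual ℝ E).symm l') h = l h := fun h => by
    rw [InnerProductSpace.toDual_symm_apply]; rfl
  refine ⟨(InnerProductSpace.toDual ℝ E).symm l' - q, fun h => ?_, fun z hz => ?_⟩
  · rw [inner_sub_right, real_inner_comm, hv, real_inner_comm]
    have := hl h
    linarith
  · rw [add_sub_cancel, inner_neg_left, hv]
    have := hlT (z - x) ⟨1, one_pos, z, hz, by simp⟩
    linarith

omit [InnerProductSpace ℝ E] in
lemma mem_prox_coe {X : Set E} {γ : ℝ} {g : E → ℝ} {w y : E}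
    (hy : y ∈ prox X γ (fun z => (g z : EReal)) w) :
    y ∈ X ∧ ∀ z ∈ X, g y + (2 * γ)⁻¹ * ‖y - w‖ ^ 2 ≤ g z + (2 * γ)⁻¹ * ‖z - w‖ ^ 2 := by
  refine ⟨hy.1, fun z hz => ?_⟩
  have := hy.2 hz
  simp only [mem_ofPred_eq] at this
  exact_mod_cast this

omit [InnerProductSpace ℝ E] in
lemma mem_prox_add_convexIndicator {X K : Set E} (hKX : K ⊆ X) (hK : K.Nonempty) {γ : ℝ}
    {g : E → ℝ} {w y : E}
    (hy : y ∈ prox X γ (fun z => (g z : EReal) + convexIndicator K z) w) :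
    y ∈ K ∧ ∀ z ∈ K, g y + (2 * γ)⁻¹ * ‖y - w‖ ^ 2 ≤ g z + (2 * γ)⁻¹ * ‖z - w‖ ^ 2 := by
  have key : ∀ z ∈ K, (g y : EReal) + convexIndicator K y +
      (((2 * γ)⁻¹ * ‖y - w‖ ^ 2 : ℝ) : EReal) ≤
      ((g z + (2 * γ)⁻¹ * ‖z - w‖ ^ 2 : ℝ) : EReal) := by
    intro z hz
    have := hy.2 (hKX hz)
    simp only [mem_ofPred_eq] at this
    simpa [convexIndicator, hz] using this
  have hyK : y ∈ K := by
    by_contra hyK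
    obtain ⟨z, hz⟩ := hK
    have h1 := key z hz
    simp only [convexIndicator, hyK, if_false] at h1
    rw [EReal.coe_add_top, EReal.top_add_coe] at h1
    exact EReal.coe_ne_top _ (top_le_iff.1 h1)
  refine ⟨hyK, fun z hz => ?_⟩
  have h1 := key z hz
  simp only [convexIndicator, hyK, if_true, add_zero] at h1
  exact_mod_cast h1

lemma mem_normalCone_of_nearest {K : Set E} (hK : Convex ℝ K) {a p : E} (hp : p ∈ K)
    (h : ∀ z ∈ K, ‖a - p‖ ≤ ‖a - z‖) : a - p ∈ normalCone K p := by
  refine (norm_eq_iInf_iff_real_inner_le_zero hK hp).1 ?_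
  have : Nonempty K := ⟨⟨p, hp⟩⟩
  refine le_antisymm (le_ciInf fun z => h z z.2) ?_
  exact ciInf_le (f := fun w : K => ‖a - w‖)
    ⟨0, by rintro _ ⟨_, rfl⟩; exact norm_nonneg _⟩ ⟨p, hp⟩

lemma smul_mem_normalCone {K : Set E} {x v : E} {c : ℝ} (hc : 0 ≤ c) (hv : v ∈ normalCone K x) :
    c • v ∈ normalCone K x := fun z hz => by
  rw [inner_smul_left]
  exact mul_nonpos_of_nonneg_of_nonpos hc (hv z hz)

/-- `x'` arises from `x` by a step of size `γ` along the negative of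
`H + ζ + ν` with `ζ` a Clarke subgradient at a point within `C γ` of `x'`, and `ν` normal to `K`
at `x'`, both bounded by `C`. -/
def IsInclusionStep (K : Set E) (g : E → ℝ) (C γ : ℝ) (x H x' : E) : Prop :=
  x' ∈ K ∧ ∃ y ζ ν : E, x' = x - γ • (H + ζ + ν) ∧ ζ ∈ clarkeGradient g y ∧
    ν ∈ normalCone K x' ∧ ‖ζ‖ ≤ C ∧ ‖ν‖ ≤ C ∧ ‖y - x'‖ ≤ C * γ

/-- Here the subgradient sits at `x'` itself. Testing the normality of `ν` against `x ∈ K` yields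
`‖x - x'‖² ≤ γ ⟨H + ζ, x - x'⟩`, hence a step of length at most `γ (M + L)`, and then `‖ν‖ ≤ 2 (M +
L)`. -/
lemma isInclusionStep_of_mem_prox [CompleteSpace E] {X K : Set E} {g : E → ℝ} (hKX : K ⊆ X)
    (hK : Convex ℝ K) (hg : ∀ x ∈ K, RegularAt g x) {L M γ : ℝ} (hL0 : 0 ≤ L)
    (hL : ∀ x ∈ K, ∀ h, clarkeDeriv g x h ≤ L * ‖h‖) (hγ : 0 < γ) {x H x' : E} (hx : x ∈ K)
    (hH : ‖H‖ ≤ M)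
    (hx' : x' ∈ prox X γ (fun z => (g z : EReal) + convexIndicator K z) (x - γ • H)) :
    IsInclusionStep K g (2 * (M + L)) γ x H x' := by
  obtain ⟨hx'K, hmin⟩ := mem_prox_add_convexIndicator hKX ⟨x, hx⟩ hx'
  have hM : 0 ≤ M := (norm_nonneg H).trans hH
  obtain ⟨ζ, hζ, hν⟩ := exists_mem_clarkeGradient_normalCone (q := γ⁻¹ • (x' - (x - γ • H)))
    (hg x' hx'K) hK hx'K (fun z hz => by
      rw [inner_smul_left]
      refine (hg x' hx'K).nonneg_of_quadratic_min hγ ?_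
      filter_upwards [Ioc_mem_nhdsGT (zero_lt_one (α := ℝ))] with t ht
      refine hmin _ ?_
      exact hK.add_smul_sub_mem hx'K hz ⟨ht.1.le, ht.2⟩)
  have hζL := norm_le_of_mem_clarkeGradient hL0 (hL x' hx'K) hζ
  set ν := -(γ⁻¹ • (x' - (x - γ • H)) + ζ) with hνdef
  have hγν : γ • ν = x - x' - γ • (H + ζ) := by
    rw [hνdef, smul_neg, smul_add, smul_smul, mul_inv_cancel₀ hγ.ne', one_smul, smul_add]
    abel
  have hstep : ‖x - x'‖ ≤ γ * (M + L) := by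
    have h1 := hν x hx
    have h2 : inner ℝ (γ • ν) (x - x') ≤ 0 := by
      rw [inner_smul_left]
      exact mul_nonpos_of_nonneg_of_nonpos hγ.le h1
    rw [hγν, inner_sub_left, real_inner_self_eq_norm_sq, inner_smul_left] at h2
    simp only [conj_trivial] at h2
    have h3 := real_inner_le_norm (H + ζ) (x - x')
    have h4 : ‖H + ζ‖ ≤ M + L := (norm_add_le _ _).trans (add_le_add hH hζL)
    have h5 : ‖x - x'‖ ^ 2 ≤ γ * (M + L) * ‖x - x'‖ := by
      have h6 : inner ℝ (H + ζ) (x - x') ≤ (M + L) * ‖x - x'‖ :=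
        h3.trans (by gcongr)
      have := mul_le_mul_of_nonneg_left h6 hγ.le
      linarith
    rcases (norm_nonneg (x - x')).eq_or_lt with h0 | h0
    · rw [← h0]; positivity
    · nlinarith
  refine ⟨hx'K, x', ζ, ν, ?_, hζ, hν, by linarith, ?_, by simp; positivity⟩
  · rw [smul_add, hγν]; abel
  · have h1 : ‖γ • ν‖ ≤ γ * (2 * (M + L)) := by
      rw [hγν]
      refine (norm_sub_le _ _).trans ?_
      rw [norm_smul, Real.norm_eq_abs, abs_of_pos hγ]
      have h4 : ‖H + ζ‖ ≤ M + L := (norm_add_le _ _).trans (add_le_add hH hζL)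
      have := mul_le_mul_of_nonneg_left h4 hγ.le
      linarith
    rw [norm_smul, Real.norm_eq_abs, abs_of_pos hγ] at h1
    exact le_of_mul_le_mul_left h1 hγ

/-- The subgradient sits at the proximal point `y`, possibly outside `K`, and `ν` is the projection
residual over `γ`. As `x ∈ K` competes in the projection, `‖y - x'‖ ≤ ‖y - x‖ ≤ (M + L) γ`. -/
lemma isInclusionStep_of_mem_projSet {X K : Set E} {g : E → ℝ} (hX : IsOpen X)
    (hK : Convex ℝ K) (hg : ∀ x ∈ X, RegularAt g x) {L : NNReal} {M γ : ℝ}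
    (hL : LipschitzOnWith L g X) (hγ : 0 < γ) {x H x' : E} (hx : x ∈ K)
    (hH : ‖H‖ ≤ M)
    (hx' : x' ∈ projSet K (prox X γ (fun z => (g z : EReal)) (x - γ • H))) :
    IsInclusionStep K g (2 * (M + L)) γ x H x' := by
  obtain ⟨y, hy, hx'K, hnear⟩ := hx'
  obtain ⟨hyX, hmin⟩ := mem_prox_coe hy
  have hM : 0 ≤ M := (norm_nonneg H).trans hH
  set ζ := -(γ⁻¹ • (y - (x - γ • H))) with hζdef
  have hζ : ζ ∈ clarkeGradient g y := by
    intro h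
    have h1 := (hg y hyX).nonneg_of_quadratic_min (w := x - γ • H) (p := h) hγ (by
      have : Tendsto (fun t : ℝ => y + t • h) (𝓝[>] 0) (𝓝 y) := by
        have hc : Continuous (fun t : ℝ => y + t • h) := by fun_prop
        have := hc.tendsto 0
        simp only [zero_smul, add_zero] at this
        exact this.mono_left nhdsWithin_le_nhds
      filter_upwards [this.eventually (hX.mem_nhds hyX)] with t ht using hmin _ ht)
    rw [hζdef, inner_neg_right, inner_smul_right, real_inner_comm]
    linarith
  have hζL : ‖ζ‖ ≤ L := norm_le_of_mem_clarkeGradient L.2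
    (clarkeDeriv_le_mul_norm (hX.mem_nhds hyX) hL) hζ
  have hyx : y = x - γ • (H + ζ) := by
    rw [hζdef, smul_add, smul_neg, smul_smul, mul_inv_cancel₀ hγ.ne', one_smul]
    abel
  have h4 : ‖H + ζ‖ ≤ M + L := (norm_add_le _ _).trans (add_le_add hH hζL)
  have hyx' : ‖y - x'‖ ≤ (M + L) * γ := by
    refine (hnear x hx).trans ?_
    rw [hyx, sub_sub_cancel_left, norm_neg, norm_smul, Real.norm_eq_abs, abs_of_pos hγ, mul_comm]
    gcongr
  have hL0 : (0 : ℝ) ≤ L := L.2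
  refine ⟨hx'K, y, ζ, γ⁻¹ • (y - x'), ?_, hζ,
    smul_mem_normalCone (inv_nonneg.2 hγ.le) (mem_normalCone_of_nearest hK hx'K hnear),
    by linarith, ?_, ?_⟩
  · rw [smul_add, smul_smul, mul_inv_cancel₀ hγ.ne', one_smul, ← sub_sub, ← hyx]
    abel
  · rw [norm_smul, Real.norm_eq_abs, abs_of_pos (inv_pos.2 hγ), inv_mul_le_iff₀ hγ]
    nlinarith [mul_nonneg (add_nonneg hM hL0) hγ.le]
  · nlinarith [mul_nonneg (add_nonneg hM hL0) hγ.le]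

end Optimality

/-! ### The time scale of the step sizes and limits of weighted sums. -/

section Clock

/-- The time elapsed after `k` steps of sizes `γ 1, …, γ k`. -/
noncomputable def clock (γ : ℕ → ℝ) (k : ℕ) : ℝ := ∑ i ∈ Finset.Icc 1 k, γ i

/-- The first index `k ≥ n` reached when the time `t` has elapsed since step `n`. -/
noncomputable def hit (γ : ℕ → ℝ) (n : ℕ) (t : ℝ) : ℕ :=
  sInf {k | n ≤ k ∧ clock γ n + t ≤ clock γ k}

variable {γ : ℕ → ℝ}

lemma clock_succ (γ : ℕ → ℝ) (k : ℕ) : clock γ (k + 1) = clock γ k + γ (k + 1) :=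
  Finset.sum_Icc_succ_top (by omega) _

lemma clock_mono (hγ : ∀ k, 1 ≤ k → 0 < γ k) : Monotone (clock γ) :=
  monotone_nat_of_le_succ fun k => by
    rw [clock_succ]
    linarith [hγ (k + 1) (by omega)]

lemma hit_mem (hsum : Tendsto (clock γ) atTop atTop) (n : ℕ) (t : ℝ) :
    n ≤ hit γ n t ∧ clock γ n + t ≤ clock γ (hit γ n t) := by
  have : {k | n ≤ k ∧ clock γ n + t ≤ clock γ k}.Nonempty := by
    obtain ⟨k, hk⟩ := ((eventually_ge_atTop n).and
      (hsum.eventually_ge_atTop (clock γ n + t))).exists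
    exact ⟨k, hk⟩
  exact Nat.sInf_mem this

lemma hit_le {n k : ℕ} {t : ℝ} (hk : n ≤ k) (h : clock γ n + t ≤ clock γ k) : hit γ n t ≤ k :=
  Nat.sInf_le ⟨hk, h⟩

lemma hit_mono (hsum : Tendsto (clock γ) atTop atTop) {n : ℕ} {s t : ℝ} (hst : s ≤ t) :
    hit γ n s ≤ hit γ n t :=
  hit_le (hit_mem hsum n t).1 (by linarith [(hit_mem hsum n t).2])

lemma hit_of_nonpos (hsum : Tendsto (clock γ) atTop atTop) (n : ℕ) {t : ℝ} (ht : t ≤ 0) :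
    hit γ n t = n :=
  le_antisymm (hit_le le_rfl (by linarith)) (hit_mem hsum n t).1

/-- The first index past the target overshoots by at most its own step; `max t 0` appears because
for `t ≤ 0` the index stays at `n`. -/
lemma clock_hit_le (hsum : Tendsto (clock γ) atTop atTop) (n : ℕ) (t : ℝ) :
    clock γ (hit γ n t) ≤ clock γ n + max t 0 + |γ (hit γ n t)| := by
  rcases (hit_mem hsum n t).1.eq_or_lt with h | h
  · rw [← h]
    linarith [le_max_right t 0, abs_nonneg (γ n)]
  · obtain ⟨m, hm⟩ : ∃ m, hit γ n t = m + 1 := ⟨hit γ n t - 1, by omega⟩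
    rw [hm, clock_succ]
    have h1 : clock γ m < clock γ n + t := by
      by_contra h2
      have := hit_le (by omega : n ≤ m) (not_lt.1 h2)
      omega
    linarith [le_max_left t 0, le_abs_self (γ (m + 1))]

lemma tendsto_hit (hsum : Tendsto (clock γ) atTop atTop) (t : ℝ) :
    Tendsto (fun n => hit γ n t) atTop atTop :=
  tendsto_atTop_mono (fun n => (hit_mem hsum n t).1) tendsto_id

lemma tendsto_clock_hit_sub (hγ : ∀ k, 1 ≤ k → 0 < γ k) (hsum : Tendsto (clock γ) atTop atTop)
    (hlim : Tendsto γ atTop (𝓝 0)) (t : ℝ) :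
    Tendsto (fun n => clock γ (hit γ n t) - clock γ n) atTop (𝓝 (max t 0)) := by
  have h1 : Tendsto (fun n => max t 0 + |γ (hit γ n t)|) atTop (𝓝 (max t 0)) := by
    simpa using ((hlim.comp (tendsto_hit hsum t)).abs).const_add (max t 0)
  refine tendsto_of_tendsto_of_tendsto_of_le_of_le tendsto_const_nhds h1 (fun n => ?_) fun n => ?_
  · refine max_le ?_ ?_
    · linarith [(hit_mem hsum n t).2]
    · linarith [clock_mono hγ (hit_mem hsum n t).1]
  · simp only
    linarith [clock_hit_le hsum n t]

variable {E : Type*} [NormedAddCommGroup E] [InnerProductSpace ℝ E]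

/-- The weighted partial sum of `u 1, …, u k` with weights `γ`. -/
noncomputable def weightedSum (γ : ℕ → ℝ) (u : ℕ → E) (k : ℕ) : E :=
  ∑ i ∈ Finset.Icc 1 k, γ i • u i

lemma weightedSum_succ (γ : ℕ → ℝ) (u : ℕ → E) (k : ℕ) :
    weightedSum γ u (k + 1) = weightedSum γ u k + γ (k + 1) • u (k + 1) :=
  Finset.sum_Icc_succ_top (by omega) _

lemma inner_weightedSum_sub_le (hγ : ∀ k, 1 ≤ k → 0 < γ k) {u : ℕ → E} {p : E} {c : ℝ} {a b : ℕ}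
    (hab : a ≤ b) (h : ∀ i, a < i → i ≤ b → inner ℝ p (u i) ≤ c) :
    inner ℝ p (weightedSum γ u b - weightedSum γ u a) ≤ c * (clock γ b - clock γ a) := by
  induction b, hab using Nat.le_induction with
  | base => simp
  | succ b hab ih =>
    have h1 := ih fun i hi hib => h i hi (by omega)
    have h2 := mul_le_mul_of_nonneg_left (h (b + 1) (by omega) le_rfl)
      (hγ (b + 1) (by omega)).le
    rw [weightedSum_succ, clock_succ, add_sub_right_comm, inner_add_right, inner_smul_right]
    linarith

lemma norm_weightedSum_sub_le (hγ : ∀ k, 1 ≤ k → 0 < γ k) {u : ℕ → E} {c : ℝ} {a b : ℕ}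
    (hab : a ≤ b) (h : ∀ i, a < i → i ≤ b → ‖u i‖ ≤ c) :
    ‖weightedSum γ u b - weightedSum γ u a‖ ≤ c * (clock γ b - clock γ a) := by
  induction b, hab using Nat.le_induction with
  | base => simp
  | succ b hab ih =>
    have h1 := ih fun i hi hib => h i hi (by omega)
    have h3 := hγ (b + 1) (by omega)
    have h2 := mul_le_mul_of_nonneg_left (h (b + 1) (by omega) le_rfl) h3.le
    rw [weightedSum_succ, clock_succ, add_sub_right_comm]
    refine (norm_add_le _ _).trans ?_
    rw [norm_smul, Real.norm_eq_abs, abs_of_pos h3]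
    linarith

/-- The `e` part is a difference of terms of a convergent sequence; the `r` part is at most its
largest norm times the elapsed time, which stays bounded. -/
lemma tendsto_weightedSum_hit_sub_zero (hγ : ∀ k, 1 ≤ k → 0 < γ k)
    (hsum : Tendsto (clock γ) atTop atTop) (hlim : Tendsto γ atTop (𝓝 0)) {δ e r : ℕ → E}
    (hδ : ∀ k, 1 ≤ k → δ k = e k + r k) (hr : Tendsto (fun k => ‖r k‖) atTop (𝓝 0))
    (he : ∃ s, Tendsto (weightedSum γ e) atTop (𝓝 s)) (t : ℝ) :
    Tendsto (fun n => weightedSum γ δ (hit γ n t) - weightedSum γ δ n) atTop (𝓝 0) := by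
  obtain ⟨s, hs⟩ := he
  have h1 : Tendsto (fun n => weightedSum γ e (hit γ n t) - weightedSum γ e n) atTop (𝓝 0) := by
    simpa using (hs.comp (tendsto_hit hsum t)).sub hs
  have h2 : Tendsto (fun n => weightedSum γ r (hit γ n t) - weightedSum γ r n) atTop (𝓝 0) := by
    rw [Metric.tendsto_atTop']
    intro ε hε
    have hB : 0 < max t 0 + 1 := by linarith [le_max_right t 0]
    have h3 := eventually_forall_ge_atTop.2
      (hr.eventually_le_const (div_pos hε (mul_pos two_pos hB)))
    have h4 := (tendsto_clock_hit_sub hγ hsum hlim t).eventually_le_const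
      (lt_add_one (max t 0))
    obtain ⟨N, hN⟩ := eventually_atTop.1 (h3.and h4)
    refine ⟨N, fun n hn => ?_⟩
    obtain ⟨h5, h6⟩ := hN n (le_of_lt hn)
    rw [dist_zero_right]
    calc _ ≤ ε / (2 * (max t 0 + 1)) * (clock γ (hit γ n t) - clock γ n) :=
          norm_weightedSum_sub_le hγ (hit_mem hsum n t).1 fun i hi _ => h5 i hi.le
      _ ≤ ε / (2 * (max t 0 + 1)) * (max t 0 + 1) := by gcongr
      _ = ε / 2 := by field_simp
      _ < ε := half_lt_self hε
  have h3 : ∀ k, weightedSum γ δ k = weightedSum γ e k + weightedSum γ r k := by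
    intro k
    rw [weightedSum, weightedSum, weightedSum, ← Finset.sum_add_distrib]
    refine Finset.sum_congr rfl fun i hi => ?_
    rw [hδ i (Finset.mem_Icc.1 hi).1, smul_add]
  have h4 := h1.add h2
  rw [add_zero] at h4
  refine h4.congr fun n => ?_
  rw [h3, h3]
  abel

variable {U : Ultrafilter ℕ}

/-- Along an ultrafilter the bounded increments converge at every `t` simultaneously, with no
diagonal subsequence. -/
lemma exists_lipschitz_weightedSum_limit [ProperSpace E] (hγ : ∀ k, 1 ≤ k → 0 < γ k)
    (hsum : Tendsto (clock γ) atTop atTop) (hlim : Tendsto γ atTop (𝓝 0))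
    (hU : (U : Filter ℕ) ≤ atTop) {u : ℕ → E} {M : ℝ} (hu : ∀ k, 1 ≤ k → ‖u k‖ ≤ M) :
    ∃ A : ℝ → E, (∃ L, LipschitzWith L A) ∧ ∀ t,
      Tendsto (fun n => weightedSum γ u (hit γ n t) - weightedSum γ u n) U (𝓝 (A t)) := by
  have hM : 0 ≤ M := (norm_nonneg _).trans (hu 1 le_rfl)
  have hex : ∀ t, ∃ a,
      Tendsto (fun n => weightedSum γ u (hit γ n t) - weightedSum γ u n) U (𝓝 a) := by
    intro t
    have h4 := (tendsto_clock_hit_sub hγ hsum hlim t).eventually_le_const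
      (lt_add_one (max t 0))
    have h5 : ∀ᶠ n in (U : Filter ℕ), weightedSum γ u (hit γ n t) - weightedSum γ u n ∈
        Metric.closedBall (0 : E) (M * (max t 0 + 1)) := by
      filter_upwards [hU h4] with n hn
      rw [mem_closedBall_zero_iff]
      refine (norm_weightedSum_sub_le hγ (hit_mem hsum n t).1
        fun i hi _ => hu i (by omega)).trans ?_
      gcongr
    obtain ⟨a, -, ha⟩ := (isCompact_closedBall (0 : E) (M * (max t 0 + 1))).ultrafilter_le_nhds
      (U.map fun n => weightedSum γ u (hit γ n t) - weightedSum γ u n)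
      (le_principal_iff.2 h5)
    exact ⟨a, ha⟩
  choose A hA using hex
  refine ⟨A, ⟨M.toNNReal, LipschitzWith.of_dist_le_mul fun t s => ?_⟩, hA⟩
  rw [Real.coe_toNNReal _ hM]
  wlog hst : s ≤ t generalizing s t
  · rw [dist_comm, dist_comm t]
    exact this s t (le_of_not_ge hst)
  have h1 : Tendsto (fun n => M * (clock γ (hit γ n t) - clock γ (hit γ n s))) atTop
      (𝓝 (M * (max t 0 - max s 0))) := by
    refine Tendsto.const_mul M ?_
    refine ((tendsto_clock_hit_sub hγ hsum hlim t).sub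
      (tendsto_clock_hit_sub hγ hsum hlim s)).congr fun n => by ring
  have h2 := le_of_tendsto_of_tendsto ((hA t).sub (hA s)).norm (h1.mono_left hU)
    (Eventually.of_forall fun n => by
      simp only [sub_sub_sub_cancel_right]
      exact norm_weightedSum_sub_le hγ (hit_mono hsum hst)
        fun i hi _ => hu i (by omega))
  rw [dist_eq_norm, Real.dist_eq]
  refine h2.trans ?_
  gcongr
  calc max t 0 - max s 0 ≤ |max t 0 - max s 0| := le_abs_self _
    _ ≤ |t - s| := abs_max_sub_max_le_abs _ _ _

/-- Averaging preserves half-spaces: one that contains the summands throughout a short window after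
`t` contains the derivative of the limit. Closed convex constraints on `ζ` and `ν` thereby reach the
velocity of the arc. -/
lemma inner_deriv_weightedSum_limit_le (hγ : ∀ k, 1 ≤ k → 0 < γ k)
    (hsum : Tendsto (clock γ) atTop atTop) (hlim : Tendsto γ atTop (𝓝 0))
    (hU : (U : Filter ℕ) ≤ atTop) {u : ℕ → E} {A : ℝ → E}
    (hA : ∀ t, Tendsto (fun n => weightedSum γ u (hit γ n t) - weightedSum γ u n) U (𝓝 (A t)))
    {t : ℝ} (ht : 0 < t) {a' p : E} {c : ℝ} (ha' : HasDerivAt A a' t)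
    (hc : ∃ ρ > 0, ∀ᶠ n in (U : Filter ℕ), ∀ i, hit γ n t < i → i ≤ hit γ n (t + ρ) →
      inner ℝ p (u i) ≤ c) : inner ℝ p a' ≤ c := by
  obtain ⟨ρ, hρ, hc⟩ := hc
  have h1 : ∀ h ∈ Ioc 0 ρ, inner ℝ p (A (t + h) - A t) ≤ c * h := by
    intro h hh
    have h2 : Tendsto (fun n => c * (clock γ (hit γ n (t + h)) - clock γ (hit γ n t))) atTop
        (𝓝 (c * h)) := by
      refine Tendsto.const_mul c ?_
      have h3 := (tendsto_clock_hit_sub hγ hsum hlim (t + h)).sub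
        (tendsto_clock_hit_sub hγ hsum hlim t)
      rw [max_eq_left ht.le, max_eq_left (add_pos ht hh.1).le, add_sub_cancel_left] at h3
      exact h3.congr fun n => by ring
    refine le_of_tendsto_of_tendsto (tendsto_const_nhds.inner ((hA (t + h)).sub (hA t)))
      (h2.mono_left hU) ?_
    filter_upwards [hc] with n hn
    simp only [sub_sub_sub_cancel_right]
    refine inner_weightedSum_sub_le hγ (hit_mono hsum (by linarith [hh.1])) fun i hi hi' => ?_
    exact hn i hi (hi'.trans (hit_mono hsum (by linarith [hh.2])))
  have h2 := (hasDerivAt_iff_tendsto_slope_zero.1 ha').mono_left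
    (nhdsWithin_mono 0 (fun s hs => ne_of_gt hs : Ioi (0 : ℝ) ⊆ {0}ᶜ))
  refine le_of_tendsto (tendsto_const_nhds.inner h2) ?_
  filter_upwards [Ioc_mem_nhdsGT hρ] with h hh
  rw [inner_smul_right, inv_mul_le_iff₀ hh.1, mul_comm]
  exact h1 h hh

omit [InnerProductSpace ℝ E] in
lemma exists_window_dist_lt (hγ : ∀ k, 1 ≤ k → 0 < γ k)
    (hsum : Tendsto (clock γ) atTop atTop) (hlim : Tendsto γ atTop (𝓝 0))
    (hU : (U : Filter ℕ) ≤ atTop) {x : ℕ → E} {C : ℝ} (hC : 0 ≤ C)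
    (hx : ∀ a b, a ≤ b → ‖x b - x a‖ ≤ C * (clock γ b - clock γ a)) {t : ℝ} (ht : 0 ≤ t) {z : E}
    (hz : Tendsto (fun n => x (hit γ n t)) U (𝓝 z)) {ε : ℝ} (hε : 0 < ε) :
    ∃ ρ > 0, ∀ᶠ n in (U : Filter ℕ), ∀ i, hit γ n t ≤ i → i ≤ hit γ n (t + ρ) →
      dist (x i) z < ε := by
  refine ⟨ε / (4 * (C + 1)), by positivity, ?_⟩
  set ρ := ε / (4 * (C + 1)) with hρdef
  have hρ : 0 < ρ := by positivity
  have h2 : Tendsto (fun n => C * (clock γ (hit γ n (t + ρ)) - clock γ (hit γ n t))) atTop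
      (𝓝 (C * ρ)) := by
    refine Tendsto.const_mul C ?_
    have h3 := (tendsto_clock_hit_sub hγ hsum hlim (t + ρ)).sub
      (tendsto_clock_hit_sub hγ hsum hlim t)
    rw [max_eq_left ht, max_eq_left (by positivity), add_sub_cancel_left] at h3
    exact h3.congr fun n => by ring
  have hCρ : C * ρ < ε / 2 := by
    have h3 : (C + 1) * ρ = ε / 4 := by rw [hρdef]; field_simp
    nlinarith
  filter_upwards [hU (h2.eventually_lt_const hCρ),
    hz.eventually (Metric.ball_mem_nhds z (half_pos hε))] with n hn1 hn2 i hi hi'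
  have h3 := hx _ _ hi
  have h4 := clock_mono hγ hi'
  have h5 : dist (x i) (x (hit γ n t)) < ε / 2 := by
    rw [dist_eq_norm]
    refine (h3.trans ?_).trans_lt hn1
    gcongr
  calc dist (x i) z ≤ dist (x i) (x (hit γ n t)) + dist (x (hit γ n t)) z := dist_triangle _ _ _
    _ < ε / 2 + ε / 2 := add_lt_add h5 hn2
    _ = ε := add_halves ε

end Clock

/-! ### The limit arc and its differential inclusion. -/

section LimitArc

variable {E : Type*} [NormedAddCommGroup E] [InnerProductSpace ℝ E]

/-- `z` is a Lipschitz arc in `K` such that at almost every time `t > 0` its velocity `w` satisfies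
`-w ∈ G (z t) + ∂g (z t) + N_K (z t)`. -/
structure IsDescentArc (K : Set E) (G : E → E) (g : E → ℝ) (z : ℝ → E) : Prop where
  lipschitz : ∃ L, LipschitzWith L z
  mem : ∀ t, z t ∈ K
  inclusion : ∀ᵐ t : ℝ, 0 < t → ∃ w, HasDerivAt z w t ∧
    ∃ ζ ∈ clarkeGradient g (z t), ∃ ν ∈ normalCone K (z t), w = -(G (z t) + ζ + ν)

lemma norm_sub_le_of_isInclusionStep {K : Set E} {g : E → ℝ} {γ : ℕ → ℝ}
    (hγ : ∀ k, 1 ≤ k → 0 < γ k) {x H : ℕ → E} {C M : ℝ} (hHM : ∀ k, 1 ≤ k → ‖H k‖ ≤ M)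
    (hstep : ∀ k, 1 ≤ k → IsInclusionStep K g C (γ k) (x (k - 1)) (H k) (x k)) {a b : ℕ}
    (hab : a ≤ b) : ‖x b - x a‖ ≤ (M + C + C) * (clock γ b - clock γ a) := by
  choose! y ζ ν hxs hζ hν hζC hνC hy using fun k hk => (hstep k hk).2
  have h1 : ∀ k, x k = x 0 - weightedSum γ (fun i => H i + ζ i + ν i) k := by
    intro k
    induction k with
    | zero => simp [weightedSum]
    | succ k ih =>
      rw [hxs (k + 1) (by omega)]
      simp only [weightedSum_succ, Nat.add_sub_cancel]
      nth_rewrite 1 [ih]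
      abel
  rw [h1 b, h1 a, sub_sub_sub_cancel_left, norm_sub_rev]
  refine norm_weightedSum_sub_le hγ hab fun i hi _ => ?_
  exact (norm_add₃_le).trans
    (add_le_add_three (hHM i (by omega)) (hζC i (by omega)) (hνC i (by omega)))

variable [FiniteDimensional ℝ E]

lemma exists_isDescentArc {K : Set E} {G : E → E} {g : E → ℝ} {γ : ℕ → ℝ}
    (hγ : ∀ k, 1 ≤ k → 0 < γ k) (hsum : Tendsto (clock γ) atTop atTop)
    (hlim : Tendsto γ atTop (𝓝 0)) {U : Ultrafilter ℕ} (hU : (U : Filter ℕ) ≤ atTop)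
    (hK : IsCompact K) (hG : ContinuousOn G K)
    (hg : ∀ x ∈ K, ∃ L : NNReal, ∃ t ∈ 𝓝 x, LipschitzOnWith L g t)
    {x H δ : ℕ → E} {C M : ℝ} (hxK : ∀ k, x k ∈ K)
    (hH : ∀ k, 1 ≤ k → H k = G (x (k - 1)) + δ k) (hHM : ∀ k, 1 ≤ k → ‖H k‖ ≤ M)
    (hδ : ∀ t, Tendsto (fun n => weightedSum γ δ (hit γ n t) - weightedSum γ δ n) atTop (𝓝 0))
    (hstep : ∀ k, 1 ≤ k → IsInclusionStep K g C (γ k) (x (k - 1)) (H k) (x k)) :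
    (∃ z : ℝ → E, IsDescentArc K G g z ∧
      ∀ t, Tendsto (fun n => x (hit γ n t)) U (𝓝 (z t))) := by
  choose! y ζ ν hxs hζ hν hζC hνC hy using fun k hk => (hstep k hk).2
  have hC : 0 ≤ C := (norm_nonneg _).trans (hζC 1 le_rfl)
  have hM : 0 ≤ M := (norm_nonneg _).trans (hHM 1 le_rfl)
  obtain ⟨M₁, hM₁⟩ := hK.exists_bound_of_continuousOn hG
  obtain ⟨D, hDL, hD⟩ := exists_lipschitz_weightedSum_limit (u := fun i => G (x (i - 1)))
    hγ hsum hlim hU fun k _ => hM₁ _ (hxK (k - 1))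
  obtain ⟨A, hAL, hA⟩ := exists_lipschitz_weightedSum_limit hγ hsum hlim hU hζC
  obtain ⟨B, hBL, hB⟩ := exists_lipschitz_weightedSum_limit hγ hsum hlim hU hνC
  obtain ⟨x₀, -, hx₀⟩ := hK.ultrafilter_le_nhds (U.map x)
    (le_principal_iff.2 (Eventually.of_forall (f := (U : Filter ℕ)) hxK))
  replace hx₀ : Tendsto x U (𝓝 x₀) := hx₀
  have hsumx : ∀ k, x k = x 0 - weightedSum γ (fun i => G (x (i - 1))) k - weightedSum γ δ k -
      weightedSum γ ζ k - weightedSum γ ν k := by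
    intro k
    induction k with
    | zero => simp [weightedSum]
    | succ k ih =>
      rw [hxs (k + 1) (by omega), hH (k + 1) (by omega)]
      simp only [weightedSum_succ, Nat.add_sub_cancel, smul_add]
      nth_rewrite 1 [ih]
      abel
  have hz : ∀ t, Tendsto (fun n => x (hit γ n t)) U (𝓝 (x₀ - D t - A t - B t)) := by
    intro t
    have h1 := (((hx₀.sub (hD t)).sub ((hδ t).mono_left hU)).sub (hA t)).sub (hB t)
    rw [sub_zero] at h1
    refine h1.congr fun n => ?_
    rw [hsumx (hit γ n t), hsumx n]
    abel
  have hzK : ∀ t, x₀ - D t - A t - B t ∈ K := fun t =>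
    hK.isClosed.mem_of_tendsto (hz t) (Eventually.of_forall fun n => hxK _)
  have hxlip : ∀ a b, a ≤ b → ‖x b - x a‖ ≤ (M + C + C) * (clock γ b - clock γ a) :=
    fun a b => norm_sub_le_of_isInclusionStep hγ hHM hstep
  obtain ⟨LD, hLD⟩ := hDL
  obtain ⟨LA, hLA⟩ := hAL
  obtain ⟨LB, hLB⟩ := hBL
  refine ⟨fun t => x₀ - D t - A t - B t,
    ⟨⟨_, (((LipschitzWith.const x₀).sub hLD).sub hLA).sub hLB⟩, hzK, ?_⟩, hz⟩
  filter_upwards [hLD.ae_differentiableAt_real, hLA.ae_differentiableAt_real,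
    hLB.ae_differentiableAt_real] with t hDt hAt hBt ht
  set z := x₀ - D t - A t - B t with hzdef
  have hwin : ∀ ε > 0, ∃ ρ > 0, ∀ᶠ n in (U : Filter ℕ), ∀ i, hit γ n t ≤ i →
      i ≤ hit γ n (t + ρ) → dist (x i) z < ε := fun ε hε =>
    exists_window_dist_lt hγ hsum hlim hU (by positivity) hxlip ht.le (hz t) hε
  have hDG : deriv D t = G z := by
    have key : ∀ p, inner ℝ p (deriv D t) ≤ inner ℝ p (G z) := by
      intro p
      refine le_of_forall_pos_le_add fun ε hε => ?_
      refine inner_deriv_weightedSum_limit_le hγ hsum hlim hU hD ht hDt.hasDerivAt ?_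
      have h1 : Tendsto (fun y => inner ℝ p (G y)) (𝓝[K] z) (𝓝 (inner ℝ p (G z))) :=
        tendsto_const_nhds.inner (hG z (hzK t))
      obtain ⟨η, hη, h2⟩ := Metric.mem_nhdsWithin_iff.1
        (h1.eventually_le_const (lt_add_of_pos_right _ hε))
      obtain ⟨ρ, hρ, h3⟩ := hwin η hη
      refine ⟨ρ, hρ, h3.mono fun n hn i hi hi' => ?_⟩
      -- The summand of index `i` is evaluated at `x (i - 1)`, so the window must include its left
      -- endpoint.
      exact h2 ⟨hn (i - 1) (by omega) (by omega), hxK _⟩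
    -- Choosing `p` as the difference of the two vectors makes the family of inequalities an
    -- equality.
    have h1 := key (deriv D t - G z)
    rw [← sub_nonpos, ← inner_sub_right] at h1
    rw [real_inner_self_eq_norm_sq] at h1
    exact sub_eq_zero.1 (norm_eq_zero.1 (pow_eq_zero_iff two_ne_zero |>.1
      (le_antisymm h1 (sq_nonneg _))))
  refine ⟨-(G z + deriv A t + deriv B t), ?_, deriv A t, ?_, deriv B t, ?_, rfl⟩
  · have h1 : -(G z + deriv A t + deriv B t) = 0 - deriv D t - deriv A t - deriv B t := by
      rw [hDG]
      abel
    rw [h1]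
    exact (((hasDerivAt_const t x₀).sub hDt.hasDerivAt).sub hAt.hasDerivAt).sub hBt.hasDerivAt
  · intro p
    refine le_of_forall_pos_le_add fun ε hε => ?_
    refine inner_deriv_weightedSum_limit_le hγ hsum hlim hU hA ht hAt.hasDerivAt ?_
    obtain ⟨η, hη, h2⟩ := Metric.mem_nhds_iff.1
      (eventually_clarkeDeriv_le (hg z (hzK t)) (lt_add_of_pos_right (clarkeDeriv g z p) hε))
    obtain ⟨ρ, hρ, h3⟩ := hwin (η / 2) (half_pos hη)
    have h4 : Tendsto (fun k => C * γ k) atTop (𝓝 0) := by simpa using hlim.const_mul C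
    have h5 := eventually_forall_ge_atTop.2 (h4.eventually_lt_const (half_pos hη))
    refine ⟨ρ, hρ, (h3.and (hU h5)).mono ?_⟩
    rintro n ⟨hn, hn'⟩ i hi hi'
    have hin : n ≤ i := (hit_mem hsum n t).1.trans hi.le
    refine (hζ i (by omega) p).trans (h2 ?_)
    rw [Metric.mem_ball]
    calc dist (y i) z ≤ dist (y i) (x i) + dist (x i) z := dist_triangle _ _ _
      _ < η / 2 + η / 2 := by
        refine add_lt_add ?_ (hn i hi.le hi')
        rw [dist_eq_norm]
        exact (hy i (by omega)).trans_lt (hn' i hin)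
      _ = η := add_halves η
  · intro v hv
    rw [real_inner_comm]
    refine le_of_forall_pos_le_add fun ε hε => ?_
    rw [zero_add]
    refine inner_deriv_weightedSum_limit_le hγ hsum hlim hU hB ht hBt.hasDerivAt ?_
    have hC1 : 0 < C + 1 := by linarith
    obtain ⟨ρ, hρ, h3⟩ := hwin (ε / (C + 1)) (by positivity)
    refine ⟨ρ, hρ, h3.mono fun n hn i hi hi' => ?_⟩
    have h1 := hn i hi.le hi'
    rw [dist_eq_norm] at h1
    have h2 : inner ℝ (v - z) (ν i) = inner ℝ (ν i) (v - x i) + inner ℝ (ν i) (x i - z) := by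
      rw [← inner_add_right, sub_add_sub_cancel, real_inner_comm]
    rw [h2]
    have h4 := hν i (by omega) v hv
    have h5 := real_inner_le_norm (ν i) (x i - z)
    have h6 := hνC i (by omega)
    have h7 : ‖ν i‖ * ‖x i - z‖ ≤ (C + 1) * (ε / (C + 1)) :=
      mul_le_mul (by linarith) h1.le (norm_nonneg _) hC1.le
    rw [mul_div_cancel₀ _ hC1.ne'] at h7
    linarith

end LimitArc

/-! ### Decrease of `f + g` along descent arcs. -/

section Lyapunov

variable {E : Type*} [NormedAddCommGroup E] [InnerProductSpace ℝ E]

/-- From the left, `z (t - h)` is `z t + h (-w)` up to `o(h)`, and `g` is Lipschitz near `z t`. The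
left side is chosen because any `ζ ∈ ∂g` then gives the upper bound `D ≤ ⟨ζ, w⟩`. -/
lemma RegularAt.hasDerivAt_comp_eq {g : E → ℝ} {z : ℝ → E} {t D : ℝ} {w : E}
    (hg : RegularAt g (z t)) (hz : HasDerivAt z w t) (hD : HasDerivAt (fun s => g (z s)) D t) :
    D = -clarkeDeriv g (z t) (-w) := by
  have hneg : Tendsto (fun h : ℝ => -h) (𝓝[>] 0) (𝓝[≠] 0) := by
    refine tendsto_nhdsWithin_iff.2 ⟨?_, ?_⟩
    · have : Tendsto (fun h : ℝ => -h) (𝓝 0) (𝓝 (-0)) := tendsto_id.neg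
      rw [neg_zero] at this
      exact this.mono_left nhdsWithin_le_nhds
    · filter_upwards [self_mem_nhdsWithin] with h hh
      exact neg_ne_zero.2 (ne_of_gt hh)
  have h1 := (hasDerivAt_iff_tendsto_slope_zero.1 hD).comp hneg
  have h2 := (hasDerivAt_iff_tendsto_slope_zero.1 hz).comp hneg
  obtain ⟨L, s, hs, hL⟩ := hg.1
  have h3 : ∀ᶠ h : ℝ in 𝓝[>] 0, z (t + -h) ∈ s := by
    have : Tendsto (fun h : ℝ => z (t + -h)) (𝓝[>] 0) (𝓝 (z t)) := by
      refine hz.continuousAt.tendsto.comp ?_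
      simpa using (hneg.mono_right nhdsWithin_le_nhds).const_add t
    exact this.eventually hs
  have h4 : ∀ᶠ h : ℝ in 𝓝[>] 0, z t + h • (-w) ∈ s := by
    have : Tendsto (fun h : ℝ => z t + h • (-w)) (𝓝[>] 0) (𝓝 (z t)) := by
      have hc : Continuous (fun h : ℝ => z t + h • (-w)) := by fun_prop
      have := hc.tendsto 0
      simp only [zero_smul, add_zero] at this
      exact this.mono_left nhdsWithin_le_nhds
    exact this.eventually hs
  have h5 : Tendsto (fun h : ℝ => L * ‖(-h)⁻¹ • (z (t + -h) - z t) - w‖) (𝓝[>] 0) (𝓝 0) := by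
    simpa using ((h2.sub_const w).norm.const_mul (L : ℝ))
  have h6 : Tendsto (fun h : ℝ => (-h)⁻¹ • (g (z (t + -h)) - g (z t)) +
      (g (z t + h • (-w)) - g (z t)) / h) (𝓝[>] 0) (𝓝 0) := by
    refine squeeze_zero_norm' ?_ h5
    filter_upwards [h3, h4, self_mem_nhdsWithin] with h hh3 hh4 hh
    have hh : 0 < h := hh
    have h7 := hL.dist_le_mul _ hh4 _ hh3
    have e1 : (-h)⁻¹ • (g (z (t + -h)) - g (z t)) + (g (z t + h • (-w)) - g (z t)) / h =
        h⁻¹ * (g (z t + h • (-w)) - g (z (t + -h))) := by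
      rw [smul_eq_mul, inv_neg, div_eq_inv_mul]
      ring
    have e2 : (-h)⁻¹ • (z (t + -h) - z t) - w =
        h⁻¹ • (z t + h • (-w) - z (t + -h)) := by
      rw [inv_neg, neg_smul, ← smul_neg, neg_sub, smul_sub, smul_sub, smul_add, smul_smul,
        inv_mul_cancel₀ hh.ne', one_smul]
      abel
    rw [e1, e2, norm_mul, norm_smul, ← mul_assoc, mul_comm (L : ℝ), mul_assoc]
    gcongr
    rwa [Real.dist_eq, dist_eq_norm] at h7
  have h8 := tendsto_nhds_unique h6 (h1.add (hg.2 (-w)))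
  linarith

lemma deriv_comp_le_neg_norm_sq [CompleteSpace E] {f g : E → ℝ} {K : Set E} {z : ℝ → E}
    {t D : ℝ} {w ζ ν : E} (hf : DifferentiableAt ℝ f (z t)) (hg : RegularAt g (z t))
    (hzK : ∀ s, z s ∈ K) (hz : HasDerivAt z w t)
    (hD : HasDerivAt (fun s => f (z s) + g (z s)) D t) (hζ : ζ ∈ clarkeGradient g (z t))
    (hν : ν ∈ normalCone K (z t)) (hw : w = -(gradient f (z t) + ζ + ν)) : D ≤ -‖w‖ ^ 2 := by
  have h1 : HasDerivAt (fun s => f (z s)) (inner ℝ (gradient f (z t)) w) t := by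
    have h2 := hf.hasGradientAt.hasFDerivAt.comp_hasDerivAt t hz
    rwa [InnerProductSpace.toDual_apply_apply] at h2
  have h2 : HasDerivAt (fun s => g (z s)) (D - inner ℝ (gradient f (z t)) w) t := by
    refine (hD.sub h1).congr_of_eventuallyEq (Eventually.of_forall fun s => ?_)
    simp
  have h3 := hg.hasDerivAt_comp_eq hz h2
  have h4 := hζ (-w)
  -- Left difference quotients of an arc staying in `K` have nonnegative product with a normal
  -- vector.
  have h5 : 0 ≤ inner ℝ ν w := by
    have h6 := (hasDerivAt_iff_tendsto_slope_zero.1 hz).mono_left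
      (nhdsWithin_mono 0 (fun s hs => ne_of_lt hs : Iio (0 : ℝ) ⊆ {0}ᶜ))
    refine ge_of_tendsto (tendsto_const_nhds.inner h6) ?_
    filter_upwards [self_mem_nhdsWithin] with s hs
    rw [inner_smul_right]
    exact mul_nonneg_of_nonpos_of_nonpos (inv_nonpos.2 (le_of_lt hs)) (hν _ (hzK _))
  have h7 : inner ℝ w w = -(inner ℝ (gradient f (z t)) w + inner ℝ ζ w + inner ℝ ν w) := by
    nth_rewrite 1 [hw]
    rw [inner_neg_left, inner_add_left, inner_add_left]
  rw [real_inner_self_eq_norm_sq] at h7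
  rw [inner_neg_left, real_inner_comm] at h4
  linarith

variable [CompleteSpace E] {K : Set E} {f g : E → ℝ} {z : ℝ → E} {L : NNReal}

lemma IsDescentArc.lipschitz_comp (hz : IsDescentArc K (gradient f) g z)
    (hL : LipschitzOnWith L (fun y => f y + g y) K) :
    ∃ M, LipschitzWith M (fun t => f (z t) + g (z t)) := by
  obtain ⟨M, hM⟩ := hz.lipschitz
  refine ⟨L * M, ?_⟩
  rw [← lipschitzOnWith_univ] at hM ⊢
  exact hL.comp hM fun t _ => hz.mem t

lemma IsDescentArc.antitone (hz : IsDescentArc K (gradient f) g z)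
    (hL : LipschitzOnWith L (fun y => f y + g y) K) (hf : ∀ y ∈ K, DifferentiableAt ℝ f y)
    (hg : ∀ y ∈ K, RegularAt g y) :
    AntitoneOn (fun t => f (z t) + g (z t)) (Ici 0) := by
  intro s hs t _ hst
  obtain ⟨M, hM⟩ := hz.lipschitz_comp hL
  have h1 := (hM.lipschitzOnWith (s := uIcc s t)).absolutelyContinuousOnInterval
    |>.integral_deriv_eq_sub
  have h2 : 0 ≤ ∫ u in s..t, -deriv (fun t => f (z t) + g (z t)) u := by
    refine intervalIntegral.integral_nonneg_of_ae_restrict hst ?_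
    rw [EventuallyLE, MeasureTheory.ae_restrict_iff' measurableSet_Icc]
    filter_upwards [hz.inclusion, hM.ae_differentiableAt_real,
      MeasureTheory.Measure.ae_ne MeasureTheory.volume (0 : ℝ)] with u hu hd hu0 hus
    have hu1 : 0 < u := lt_of_le_of_ne (le_trans hs hus.1) (Ne.symm hu0)
    obtain ⟨w, hw, ζ, hζ, ν, hν, hsum⟩ := hu hu1
    have := deriv_comp_le_neg_norm_sq (hf _ (hz.mem u)) (hg _ (hz.mem u)) hz.mem hw
      hd.hasDerivAt hζ hν hsum
    simp only [Pi.zero_apply]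
    nlinarith [sq_nonneg ‖w‖]
  rw [intervalIntegral.integral_neg, h1] at h2
  simp only
  linarith

/-- A zero derivative of `f + g` forces zero velocity almost everywhere, so the arc is constant on
`[0, T]`; the inclusion at one good interior time is therefore stationarity of `z 0`. -/
lemma IsDescentArc.mem_stationarySet (hz : IsDescentArc K (gradient f) g z)
    (hL : LipschitzOnWith L (fun y => f y + g y) K) (hf : ∀ y ∈ K, DifferentiableAt ℝ f y)
    (hg : ∀ y ∈ K, RegularAt g y) {T : ℝ} (hT : 0 < T)
    (hconst : f (z T) + g (z T) = f (z 0) + g (z 0)) : z 0 ∈ stationarySet K f g := by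
  have hanti := hz.antitone hL hf hg
  have hV : ∀ t ∈ Icc 0 T, f (z t) + g (z t) = f (z 0) + g (z 0) := fun t ht =>
    le_antisymm (hanti (mem_Ici.2 le_rfl) ht.1 ht.1)
      (hconst ▸ hanti ht.1 (mem_Ici.2 hT.le) ht.2)
  have key : ∀ᵐ t : ℝ, t ∈ Ioo 0 T → HasDerivAt z 0 t ∧
      ∃ ζ ∈ clarkeGradient g (z t), ∃ ν ∈ normalCone K (z t),
        gradient f (z t) + ζ + ν = 0 := by
    filter_upwards [hz.inclusion] with t ht ht0
    obtain ⟨w, hw, ζ, hζ, ν, hν, hsum⟩ := ht ht0.1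
    have hD : HasDerivAt (fun s => f (z s) + g (z s)) 0 t := by
      refine (hasDerivAt_const t (f (z 0) + g (z 0))).congr_of_eventuallyEq ?_
      filter_upwards [Icc_mem_nhds ht0.1 ht0.2] with s hs using hV s hs
    have h1 := deriv_comp_le_neg_norm_sq (hf _ (hz.mem t)) (hg _ (hz.mem t)) hz.mem hw
      hD hζ hν hsum
    have hw0 : w = 0 := by
      have : ‖w‖ ^ 2 = 0 := le_antisymm (by linarith) (sq_nonneg _)
      simpa using this
    subst hw0
    exact ⟨hw, ζ, hζ, ν, hν, neg_eq_zero.1 hsum.symm⟩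
  obtain ⟨M, hM⟩ := hz.lipschitz
  obtain ⟨c, hc⟩ := (hM.lipschitzOnWith
    (s := uIcc 0 T)).absolutelyContinuousOnInterval.const_of_ae_hasDerivAt_zero (by
      filter_upwards [key, MeasureTheory.Measure.ae_ne MeasureTheory.volume (0 : ℝ),
        MeasureTheory.Measure.ae_ne MeasureTheory.volume T] with t ht h0 h1 htT
      rw [uIcc_of_le hT.le] at htT
      exact (ht ⟨lt_of_le_of_ne htT.1 (Ne.symm h0), lt_of_le_of_ne htT.2 h1⟩).1)
  rw [uIcc_of_le hT.le] at hc
  obtain ⟨t, ht, hkey⟩ := (MeasureTheory.Measure.dense_of_ae key).exists_mem_open isOpen_Ioo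
    (nonempty_Ioo.2 hT)
  obtain ⟨-, ζ, hζ, ν, hν, hsum⟩ := ht hkey
  have hzt : z t = z 0 := by
    rw [hc t ⟨hkey.1.le, hkey.2.le⟩, hc 0 ⟨le_rfl, hT.le⟩]
  rw [hzt] at hζ hν hsum
  refine ⟨hz.mem 0, ?_⟩
  rw [← hsum]
  exact add_mem_add (add_mem_add rfl hζ) hν

end Lyapunov

/-! ### Upcrossings and convergence to the stationary set. -/

section Convergence

variable {E : Type*} [NormedAddCommGroup E] [InnerProductSpace ℝ E]

/-- The start is the last index before `m` at which `V ≤ a`. -/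
lemma frequently_upcrossing_start {V : ℕ → ℝ} {a b : ℝ} (hab : a < b)
    (ha : ∃ᶠ n in atTop, V n < a) (hb : ∃ᶠ n in atTop, b < V n) :
    ∃ᶠ n in atTop, V n ≤ a ∧ ∃ m, n < m ∧ b < V m ∧ ∀ k, n < k → k ≤ m → a < V k := by
  rw [frequently_atTop] at ha hb ⊢
  intro N
  obtain ⟨n₀, hn₀, han₀⟩ := ha N
  obtain ⟨m, hm, hbm⟩ := hb n₀
  have h1 := Nat.findGreatest_spec (P := fun k => V k ≤ a) hm han₀.le
  have h2 := Nat.le_findGreatest (P := fun k => V k ≤ a) hm han₀.le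
  have h3 := Nat.findGreatest_le (P := fun k => V k ≤ a) m
  refine ⟨Nat.findGreatest (fun k => V k ≤ a) m, hn₀.trans h2, h1, m, ?_, hbm, fun k hk hkm => ?_⟩
  · refine lt_of_le_of_ne h3 fun h => ?_
    rw [h] at h1
    linarith
  · exact not_le.1 (Nat.findGreatest_is_greatest hk hkm)

omit [InnerProductSpace ℝ E] in
lemma norm_sub_le_mul_abs_clock {γ : ℕ → ℝ} {x : ℕ → E} {C : ℝ} (hC : 0 ≤ C)
    (hx : ∀ a b, a ≤ b → ‖x b - x a‖ ≤ C * (clock γ b - clock γ a)) (a b : ℕ) :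
    ‖x b - x a‖ ≤ C * |clock γ b - clock γ a| := by
  rcases le_total a b with h | h
  · exact (hx a b h).trans (by gcongr; exact le_abs_self _)
  · rw [norm_sub_rev, abs_sub_comm]
    exact (hx b a h).trans (by gcongr; exact le_abs_self _)

variable [FiniteDimensional ℝ E]

/-- A proximal gradient sequence with asymptotically negligible noise converges to the set of
stationary points as soon as the set of stationary values has empty interior. -/
theorem convergesToSet_of_isInclusionStep {K : Set E} {f g : E → ℝ} {γ : ℕ → ℝ}
    (hγ : ∀ k, 1 ≤ k → 0 < γ k) (hsum : Tendsto (clock γ) atTop atTop)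
    (hlim : Tendsto γ atTop (𝓝 0)) (hK : IsCompact K) {L : NNReal}
    (hL : LipschitzOnWith L (fun y => f y + g y) K) (hf : ∀ y ∈ K, DifferentiableAt ℝ f y)
    (hf' : ContinuousOn (gradient f) K) (hg : ∀ y ∈ K, RegularAt g y)
    (hS : interior ((fun y => f y + g y) '' stationarySet K f g) = ∅)
    {x H δ : ℕ → E} {C M : ℝ} (hxK : ∀ k, x k ∈ K)
    (hH : ∀ k, 1 ≤ k → H k = gradient f (x (k - 1)) + δ k) (hHM : ∀ k, 1 ≤ k → ‖H k‖ ≤ M)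
    (hδ : ∀ t, Tendsto (fun n => weightedSum γ δ (hit γ n t) - weightedSum γ δ n) atTop (𝓝 0))
    (hstep : ∀ k, 1 ≤ k → IsInclusionStep K g C (γ k) (x (k - 1)) (H k) (x k)) :
    ConvergesToSet x (stationarySet K f g) := by
  set V : E → ℝ := fun y => f y + g y
  have hC : 0 ≤ C := by
    obtain ⟨-, -, ζ, -, -, -, -, h, -⟩ := hstep 1 le_rfl
    exact (norm_nonneg ζ).trans h
  have hM : 0 ≤ M := (norm_nonneg _).trans (hHM 1 le_rfl)
  have hxlip : ∀ a b, a ≤ b → ‖x b - x a‖ ≤ (M + C + C) * (clock γ b - clock γ a) :=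
    fun a b => norm_sub_le_of_isInclusionStep hγ hHM hstep
  have hVlim : ∀ {U : Ultrafilter ℕ} {i : ℕ → ℕ} {p : E}, p ∈ K →
      Tendsto (fun n => x (i n)) U (𝓝 p) → Tendsto (fun n => V (x (i n))) U (𝓝 (V p)) := by
    intro U i p hp hi
    exact (hL.continuousOn p hp).tendsto.comp
      (tendsto_nhdsWithin_iff.2 ⟨hi, Eventually.of_forall fun n => hxK _⟩)
  have harc : ∀ {U : Ultrafilter ℕ}, (U : Filter ℕ) ≤ atTop → ∃ z : ℝ → E,
      IsDescentArc K (gradient f) g z ∧ ∀ t, Tendsto (fun n => x (hit γ n t)) U (𝓝 (z t)) :=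
    fun hU => exists_isDescentArc hγ hsum hlim hU hK hf' (fun y hy => (hg y hy).1) hxK hH hHM hδ
      hstep
  have hhit0 : ∀ n, hit γ n 0 = n := fun n => hit_of_nonpos hsum n le_rfl
  obtain ⟨R, hR⟩ := hK.exists_bound_of_continuousOn hL.continuousOn
  have hdense : Dense ((V '' stationarySet K f g)ᶜ) := interior_eq_empty_iff_dense_compl.1 hS
  obtain ⟨c, hc⟩ : ∃ c, Tendsto (fun n => V (x n)) atTop (𝓝 c) := by
    refine tendsto_of_no_upcrossings hdense ?_
      ⟨R, eventually_map.2 (Eventually.of_forall fun n => (abs_le.1 (hR _ (hxK n))).2)⟩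
      ⟨-R, eventually_map.2 (Eventually.of_forall fun n => (abs_le.1 (hR _ (hxK n))).1)⟩
    rintro a ha b - hab ⟨hfa, hfb⟩
    have hfreq := frequently_upcrossing_start hab hfa hfb
    have hne := Filter.frequently_iff_neBot.1 hfreq
    obtain ⟨U, hU⟩ := @Ultrafilter.exists_le _ _ hne
    have hUtop : (U : Filter ℕ) ≤ atTop := hU.trans inf_le_left
    have hUA := le_principal_iff.1 (hU.trans inf_le_right)
    obtain ⟨z, hz, hzlim⟩ := harc hUtop
    have hz0 : Tendsto (fun n => x n) U (𝓝 (z 0)) := by simpa only [hhit0] using hzlim 0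
    -- The starting values are at most `a`, the next ones exceed `a`, and consecutive iterates have
    -- the same limit.
    have hVz0 : V (z 0) = a := by
      refine le_antisymm (le_of_tendsto (hVlim (hz.mem 0) hz0) ?_) ?_
      · filter_upwards [hUA] with n hn using hn.1
      · have h1 : Tendsto (fun n => x (n + 1) - x n) atTop (𝓝 0) := by
          have h2 : Tendsto (fun n => (M + C + C) * γ (n + 1)) atTop (𝓝 0) := by
            simpa using (hlim.comp (tendsto_add_atTop_nat 1)).const_mul (M + C + C)
          refine squeeze_zero_norm (fun n => ?_) h2
          have := hxlip n (n + 1) (by omega)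
          rwa [clock_succ, add_sub_cancel_left] at this
        have h2 : Tendsto (fun n => x (n + 1)) U (𝓝 (z 0)) := by
          simpa using hz0.add (h1.mono_left hUtop)
        refine ge_of_tendsto (hVlim (hz.mem 0) h2) ?_
        filter_upwards [hUA] with n hn
        obtain ⟨-, m, hnm, -, h3⟩ := hn
        exact (h3 (n + 1) (by omega) (by omega)).le
    have hanti := hz.antitone hL hf hg
    have hlt : V (z 1) < a := by
      rw [← hVz0]
      refine lt_of_le_of_ne (hanti (mem_Ici.2 le_rfl) (mem_Ici.2 zero_le_one) zero_le_one)
        fun h => ha ⟨z 0, hz.mem_stationarySet hL hf hg one_pos h, hVz0⟩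
    choose! m hm using fun n
      (hn : ∃ m, n < m ∧ b < V (x m) ∧ ∀ k, n < k → k ≤ m → a < V (x k)) => hn
    have hclock := tendsto_clock_hit_sub hγ hsum hlim
    -- At elapsed time 1 the value is already below `a`, which is impossible inside an upcrossing.
    have hlate : ∀ᶠ n in (U : Filter ℕ), m n ≤ hit γ n 1 := by
      have h1 : Tendsto (fun n => clock γ (hit γ n 1) - clock γ n) atTop (𝓝 1) := by
        simpa using hclock 1
      filter_upwards [hUA, (hVlim (hz.mem 1) (hzlim 1)).eventually_lt_const hlt,
        hUtop (h1.eventually_const_lt one_pos)] with n hn h2 h3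
      by_contra h4
      have h5 : n < hit γ n 1 := by
        refine lt_of_le_of_ne (hit_mem hsum n 1).1 fun h6 => ?_
        rw [← h6, sub_self] at h3
        exact lt_irrefl _ h3
      exact lt_asymm h2 ((hm n hn.2).2.2 _ h5 (not_le.1 h4).le)
    have hwin : ∀ᶠ n in (U : Filter ℕ), clock γ (m n) - clock γ n ∈ Icc (0 : ℝ) 2 := by
      have h1 : Tendsto (fun n => clock γ (hit γ n 1) - clock γ n) atTop (𝓝 1) := by
        simpa using hclock 1
      filter_upwards [hUA, hlate, hUtop (h1.eventually_le_const one_lt_two)] with n hn h2 h3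
      have h4 := clock_mono hγ h2
      have h5 := clock_mono hγ (hm n hn.2).1.le
      exact ⟨by linarith, by linarith⟩
    obtain ⟨s, hs, hslim⟩ := (isCompact_Icc (a := (0 : ℝ)) (b := 2)).ultrafilter_le_nhds
      (U.map fun n => clock γ (m n) - clock γ n) (le_principal_iff.2 hwin)
    replace hslim : Tendsto (fun n => clock γ (m n) - clock γ n) U (𝓝 s) := hslim
    -- With `s` the limiting duration of the upcrossings, `m n` and `hit γ n s` are asymptotically
    -- simultaneous, so their iterates merge.
    have hxm : Tendsto (fun n => x (m n)) U (𝓝 (z s)) := by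
      have h1 : Tendsto (fun n => clock γ (m n) - clock γ (hit γ n s)) U (𝓝 0) := by
        have h2 := hslim.sub ((hclock s).mono_left hUtop)
        rw [max_eq_left hs.1, sub_self] at h2
        exact h2.congr fun n => by ring
      have h2 : Tendsto (fun n => x (m n) - x (hit γ n s)) U (𝓝 0) := by
        refine squeeze_zero_norm (fun n => norm_sub_le_mul_abs_clock (by positivity) hxlip _ _) ?_
        simpa using h1.abs.const_mul (M + C + C)
      simpa using h2.add (hzlim s)
    have h1 : b ≤ V (z s) := by
      refine ge_of_tendsto (hVlim (hz.mem s) hxm) ?_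
      filter_upwards [hUA] with n hn using (hm n hn.2).2.1.le
    have h2 : V (z s) ≤ V (z 0) := hanti (mem_Ici.2 le_rfl) (mem_Ici.2 hs.1) hs.1
    linarith
  by_contra hcon
  obtain ⟨ε, hε, hfreq⟩ : ∃ ε > 0, ∃ᶠ n in atTop,
      ε < Metric.infEDist (x n) (stationarySet K f g) := by
    unfold ConvergesToSet at hcon
    rw [ENNReal.tendsto_nhds_zero] at hcon
    push Not at hcon
    obtain ⟨ε, hε, h⟩ := hcon
    exact ⟨ε, hε, h.mono fun n hn => hn⟩
  have hne := Filter.frequently_iff_neBot.1 hfreq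
  obtain ⟨U, hU⟩ := @Ultrafilter.exists_le _ _ hne
  have hUtop : (U : Filter ℕ) ≤ atTop := hU.trans inf_le_left
  obtain ⟨z, hz, hzlim⟩ := harc hUtop
  have hVz : ∀ t, V (z t) = c := fun t => tendsto_nhds_unique (hVlim (hz.mem t) (hzlim t))
    ((hc.comp (tendsto_hit hsum t)).mono_left hUtop)
  have hmem : z 0 ∈ stationarySet K f g :=
    hz.mem_stationarySet hL hf hg one_pos ((hVz 1).trans (hVz 0).symm)
  have hz0 : Tendsto (fun n => x n) U (𝓝 (z 0)) := by simpa only [hhit0] using hzlim 0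
  have h1 : ∀ᶠ n in (U : Filter ℕ), edist (x n) (z 0) < ε :=
    hz0.eventually (Metric.eball_mem_nhds (z 0) hε)
  obtain ⟨n, hn, hn'⟩ := (h1.and (le_principal_iff.1 (hU.trans inf_le_right))).exists
  exact absurd (hn'.trans_le (Metric.infEDist_le_edist_of_mem hmem)) (not_lt.2 hn.le)

end Convergence

end ProxSGD

/-! ### The two proximal schemes. -/

theorem mainTheorem5 (d : ℕ)
    (X K : Set (EuclideanSpace ℝ (Fin d))) (hX : IsOpen X)
    (hKconv : Convex ℝ K) (hKcomp : IsCompact K) (hKX : K ⊆ X)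
    (f g : EuclideanSpace ℝ (Fin d) → ℝ)
    -- `f` is continuously differentiable; `g` is locally Lipschitz, bounded below and regular
    (hf : ContDiffOn ℝ 1 f X)
    (hg_lip : LocallyLipschitzOn X g)
    (hg_bdd : BddBelow (g '' X))
    (hg_reg : ∀ x ∈ X, ProxSGD.RegularAt g x)
    -- step sizes
    (γ : ℕ → ℝ) (hγ_pos : ∀ k : ℕ, 1 ≤ k → 0 < γ k)
    (hγ_sum : Tendsto (fun n : ℕ => ∑ k ∈ Finset.Icc 1 n, γ k) atTop atTop)
    (hγ_lim : Tendsto γ atTop (𝓝 0))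
    -- the values of `f + g` at the stationary points
    (hS : interior ((fun x => f x + g x) '' ProxSGD.stationarySet K f g) = ∅)
    -- the iterates, the gradient estimates and the noise
    (x H : ℕ → EuclideanSpace ℝ (Fin d)) (hx0 : x 0 ∈ K)
    (hnoise : ∃ e r : ℕ → EuclideanSpace ℝ (Fin d),
      (∀ k : ℕ, 1 ≤ k → ProxSGD.gradNoise f x H k = e k + r k) ∧
      Tendsto (fun k => ‖r k‖) atTop (𝓝 0) ∧
      ∃ s, Tendsto (fun n : ℕ => ∑ k ∈ Finset.Icc 1 n, γ k • e k) atTop (𝓝 s))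
    (hnoise_bdd : ∃ C : ℝ, ∀ k : ℕ, 1 ≤ k → ‖ProxSGD.gradNoise f x H k‖ ≤ C) :
    ((∀ k : ℕ, 1 ≤ k →
        x k ∈ ProxSGD.prox X (γ k) (fun y => (g y : EReal) + ProxSGD.convexIndicator K y)
          (x (k - 1) - γ k • H k)) →
      ProxSGD.ConvergesToSet x (ProxSGD.stationarySet K f g)) ∧
    ((∃ L : NNReal, LipschitzOnWith L g X) →
      (∀ k : ℕ, 1 ≤ k →
        x k ∈ ProxSGD.projSet K
          (ProxSGD.prox X (γ k) (fun y => (g y : EReal)) (x (k - 1) - γ k • H k))) →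
      ProxSGD.ConvergesToSet x (ProxSGD.stationarySet K f g)) := by
  obtain ⟨e, r, her, hr, he⟩ := hnoise
  obtain ⟨B, hB⟩ := hnoise_bdd
  have hregK : ∀ y ∈ K, ProxSGD.RegularAt g y := fun y hy => hg_reg y (hKX hy)
  have hfd : ∀ y ∈ X, DifferentiableAt ℝ f y := fun y hy =>
    (hf.differentiableOn one_ne_zero).differentiableAt (hX.mem_nhds hy)
  have hgrad : ContinuousOn (gradient f) K :=
    ((InnerProductSpace.toDual ℝ _).symm.continuous.comp_continuousOn
      (hf.continuousOn_fderiv_of_isOpen hX le_rfl)).mono hKX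
  obtain ⟨Lf, hLf⟩ := (hf.mono hKX).exists_lipschitzOnWith one_ne_zero hKconv hKcomp
  obtain ⟨Lg, hLg⟩ := (hg_lip.mono hKX).exists_lipschitzOnWith_of_compact hKcomp
  have hH : ∀ k, 1 ≤ k → H k = gradient f (x (k - 1)) + ProxSGD.gradNoise f x H k := fun k _ =>
    (add_sub_cancel _ _).symm
  have hδ := ProxSGD.tendsto_weightedSum_hit_sub_zero hγ_pos hγ_sum hγ_lim her hr he
  obtain ⟨G, hG⟩ := hKcomp.exists_bound_of_continuousOn hgrad
  have hHM : (∀ k, x k ∈ K) → ∀ k, 1 ≤ k → ‖H k‖ ≤ G + B := fun hxK k hk => by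
    rw [hH k hk]
    exact (norm_add_le _ _).trans (add_le_add (hG _ (hxK _)) (hB k hk))
  have main : ∀ C : ℝ, (∀ k, x k ∈ K) →
      (∀ k, 1 ≤ k → ProxSGD.IsInclusionStep K g C (γ k) (x (k - 1)) (H k) (x k)) →
      ProxSGD.ConvergesToSet x (ProxSGD.stationarySet K f g) := fun C hxK hstep =>
    ProxSGD.convergesToSet_of_isInclusionStep hγ_pos hγ_sum hγ_lim hKcomp (hLf.add hLg)
      (fun y hy => hfd y (hKX hy)) hgrad hregK hS hxK hH (hHM hxK) hδ hstep
  have hxK_of : (∀ k, 1 ≤ k → x k ∈ K) → ∀ k, x k ∈ K := fun h k =>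
    k.eq_zero_or_pos.elim (fun hk => hk ▸ hx0) (h k)
  refine ⟨fun hx => ?_, ?_⟩
  · have hxK := hxK_of fun k hk =>
      (ProxSGD.mem_prox_add_convexIndicator hKX ⟨x 0, hx0⟩ (hx k hk)).1
    -- In (i) all subgradients are taken in `K`, where compactness bounds them; in (ii) they are
    -- taken in `X`, and the global Lipschitz constant plays this role.
    obtain ⟨L, hL0, hL⟩ := ProxSGD.exists_clarkeDeriv_le_on_compact hKcomp
      fun y hy => (hregK y hy).1
    exact main _ hxK fun k hk => ProxSGD.isInclusionStep_of_mem_prox hKX hKconv hregK hL0 hL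
      (hγ_pos k hk) (hxK _) (hHM hxK k hk) (hx k hk)
  · rintro ⟨L, hL⟩ hx
    have hxK := hxK_of fun k hk => (hx k hk).elim fun _ h => h.2.1
    exact main _ hxK fun k hk => ProxSGD.isInclusionStep_of_mem_projSet hX hKconv hg_reg hL
      (hγ_pos k hk) (hxK _) (hHM hxK k hk) (hx k hk)
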